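/- Let $d\ge 1$ be an integer. A measurement $\Lambda$ of a qudit $\mathbb C^d$ with $N$ outcomes is given by positive semidefinite $d\times d$ matrices $M_1,\dots,M_N$ with $\sum_x M_x=I$; for an operator $\xi$ on $(\mathbb C^d)^{\otimes k}$ let $\Lambda^{\otimes k}(\xi)$ be the vector with the entries $\operatorname{tr}\big((M_{x_1}\otimes\cdots\otimes M_{x_k})\,\xi\big)$, $x\in\{1,\dots,N\}^k$, and let $\|\Lambda^{\otimes k}(\xi)\|_1$ be the sum of their moduli. Let $\|\xi\|_1$ be the trace norm. Call $\Lambda$ tomographic if $N\le d^8$ and $$\frac{1}{(18d)^{k/2}}\,\|\xi\|_1\le\|\Lambda^{\otimes k}(\xi)\|_1\qquad\text{for every integer }k\ge 1\text{ and every traceless operator }\xi\text{ on }(\mathbb C^d)^{\otimes k}.$$ **Theorem (quantum de Finetti theorem without symmetry).** A tomographic measurement of $\mathbb C^d$ exists. Moreover, let $\Lambda$ be any tomographic measurement of $\mathbb C^d$, let $n,k\ge 0$ be integers, let $\rho=\rho^{Q_1\ldots Q_n}$ be a density matrix on $(\mathbb C^d)^{\otimes n}$, and let $t$ be an integer with $1\le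 t\le n-k$. Then there is an integer $m$ with $0\le m\le t$ such that $$\mathop{\mathbb E}_{\vec j,\,\vec x}\ \mathop{\mathbb E}_{\vec i}\ \Big\|\rho_{\vec j,\vec x}^{Q_{i_1}\ldots Q_{i_k}}-\rho_{\vec j,\vec x}^{Q_{i_1}}\otimes\cdots\otimes\rho_{\vec j,\vec x}^{Q_{i_k}}\Big\|_1^2\ \le\ \frac{4\ln(d)\,(18d)^k\,k^2}{t}.$$ Here $\vec j=(j_1,\dots,j_m)$ and $\vec i=(i_1,\dots,i_k)$ are uniformly random disjoint tuples of distinct elements of $\{1,\dots,n\}$; $\vec x=(x_1,\dots,x_m)$ are the outcomes of measuring each of the sites $Q_{j_1},\dots,Q_{j_m}$ of $\rho$ with $\Lambda$; $\rho_{\vec j,\vec x}$ is the post-measurement state of the remaining $n-m$ sites, conditioned on the outcomes $\vec x$; and superscripts denote reduced states (partial trace over all other sites). -/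

import Mathlib

open scoped BigOperators Matrix ComplexOrder

noncomputable section

namespace DeFinetti

/-- Operators on `(ℂ^d)^{⊗ ι}`: one qudit for every site in `ι`, written as matrices in the
product basis, whose elements are indexed by the functions `ι → Fin d`. -/
abbrev QuditOp (d : ℕ) (ι : Type) : Type := Matrix (ι → Fin d) (ι → Fin d) ℂ

/-- Density operators: positive semidefinite of trace one. -/
def IsDensity {d : ℕ} {ι : Type} [Fintype ι] [DecidableEq ι] (ρ : QuditOp d ι) : Prop :=
  ρ.PosSemidef ∧ ρ.trace = 1

/-- The trace norm `‖A‖₁ = tr √(A* A)`: the sum of the singular values of `A`, i.e. of the square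
roots of the eigenvalues of `A* A`. -/
def traceNorm {β : Type} [Fintype β] [DecidableEq β] (A : Matrix β β ℂ) : ℝ :=
  ∑ b, Real.sqrt ((Matrix.isHermitian_conjTranspose_mul_self A).eigenvalues b)

/-- The tensor product `⨂_{l} A_l` of one-qudit operators. -/
def tensorOp {d : ℕ} {κ : Type} [Fintype κ] (A : κ → Matrix (Fin d) (Fin d) ℂ) : QuditOp d κ :=
  Matrix.of fun a b => ∏ l, A l (a l) (b l)

/-- A measurement of a qudit with `N` outcomes (a POVM). -/
structure Measurement (d N : ℕ) where
  effect : Fin N → Matrix (Fin d) (Fin d) ℂ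
  posSemidef : ∀ x, (effect x).PosSemidef
  sum_eq_one : ∑ x, effect x = 1

/-- `Λ^{⊗ κ}(ξ)`, as the function `x ↦ tr((⨂_l M_{x_l}) ξ)` of the outcomes. (The operator
`Λ^{⊗ κ}(ξ)` is diagonal in the outcome basis, with these diagonal entries.) -/
def Measurement.apply {d N : ℕ} (M : Measurement d N) {κ : Type} [Fintype κ] [DecidableEq κ]
    (ξ : QuditOp d κ) (x : κ → Fin N) : ℂ :=
  (tensorOp (fun l => M.effect (x l)) * ξ).trace

/-- At most `d ^ 8` outcomes, and
`‖ξ‖₁ / (18 d)^{k/2} ≤ ‖Λ^{⊗ k}(ξ)‖₁` for all `k ≥ 1` and all traceless operators `ξ` on `k` qudits.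
The 1-norm of the diagonal operator `Λ^{⊗ k}(ξ)` is the sum of the moduli of its entries. -/
def Measurement.IsTomographic {d N : ℕ} (M : Measurement d N) : Prop :=
  N ≤ d ^ 8 ∧
    ∀ k : ℕ, 0 < k → ∀ ξ : QuditOp d (Fin k), ξ.trace = 0 →
      1 / (18 * (d : ℝ)) ^ ((k : ℝ) / 2) * traceNorm ξ ≤ ∑ x : Fin k → Fin N, ‖M.apply ξ x‖

/-- The reduced operator on the (ordered) sites `i`: the partial trace over all other sites. -/
def marginal {d : ℕ} {ι κ : Type} [Fintype ι] [DecidableEq ι] [Fintype κ]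
    (ρ : QuditOp d ι) (i : κ ↪ ι) : QuditOp d κ :=
  Matrix.of fun a b => ∑ u : ι → Fin d, ∑ v : ι → Fin d,
    if (∀ l, u (i l) = a l) ∧ (∀ l, v (i l) = b l) ∧ (∀ s, (∀ l, i l ≠ s) → u s = v s)
    then ρ u v else 0

/-- The reduced operator on the single site `s`. -/
def siteMarginal {d : ℕ} {ι : Type} [Fintype ι] [DecidableEq ι]
    (ρ : QuditOp d ι) (s : ι) : Matrix (Fin d) (Fin d) ℂ :=
  Matrix.of fun a b =>
    marginal ρ ⟨fun _ : Unit => s, fun _ _ _ => rfl⟩ (fun _ => a) (fun _ => b)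

/-- The sites that are not among `j_1, …, j_m`. -/
abbrev Rest {n m : ℕ} (j : Fin m ↪ Fin n) : Type := {s : Fin n // ∀ l, j l ≠ s}

/-- The unnormalized state `tr_{Q_j} ((M_{x_1} ⊗ ⋯ ⊗ M_{x_m})^{Q_j} ρ)` on the remaining sites
after measuring the sites `j_1, …, j_m` with outcomes `x_1, …, x_m`. -/
def unnormalizedPost {d N n m : ℕ} (M : Measurement d N) (ρ : QuditOp d (Fin n))
    (j : Fin m ↪ Fin n) (x : Fin m → Fin N) : QuditOp d (Rest j) :=
  Matrix.of fun a b => ∑ u : Fin n → Fin d, ∑ v : Fin n → Fin d,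
    if (∀ s : Rest j, u s = a s) ∧ (∀ s : Rest j, v s = b s)
    then (∏ l, M.effect (x l) (v (j l)) (u (j l))) * ρ u v else 0

/-- The probability of the outcomes `x` when the sites `j` are measured. -/
def outcomeProb {d N n m : ℕ} (M : Measurement d N) (ρ : QuditOp d (Fin n))
    (j : Fin m ↪ Fin n) (x : Fin m → Fin N) : ℝ :=
  (unnormalizedPost M ρ j x).trace.re

/-- The post-measurement state `ρ_{j,x}` of the remaining sites, conditioned on the outcomes `x`
(meaningful for outcomes of positive probability; the others have weight zero below). -/
def postState {d N n m : ℕ} (M : Measurement d N) (ρ : QuditOp d (Fin n))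
    (j : Fin m ↪ Fin n) (x : Fin m → Fin N) : QuditOp d (Rest j) :=
  ((outcomeProb M ρ j x : ℝ) : ℂ)⁻¹ • unnormalizedPost M ρ j x

/-- `𝔼_{j,x} 𝔼_i ‖ρ_{j,x}^{Q_{i_1} ⋯ Q_{i_k}} - ρ_{j,x}^{Q_{i_1}} ⊗ ⋯ ⊗ ρ_{j,x}^{Q_{i_k}}‖₁²`, where
`j` is a uniformly random ordered `m`-subset of the sites, `x` are the outcomes of measuring the
sites `j`, and `i` is a uniformly random ordered `k`-subset of the remaining sites. -/
def meanSqDistToProduct {d N n : ℕ} (M : Measurement d N) (ρ : QuditOp d (Fin n)) (k m : ℕ) : ℝ :=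
  𝔼 j : Fin m ↪ Fin n, ∑ x : Fin m → Fin N, outcomeProb M ρ j x *
    𝔼 i : Fin k ↪ Rest j,
      traceNorm (marginal (postState M ρ j x) i
        - tensorOp (fun l => siteMarginal (postState M ρ j x) (i l))) ^ 2

end DeFinetti

end

/-!
**Existence.** Take the effects `w x • v x (v x)*`, where the vectors `v x` with the weights `w x`
have the moments of bidegree `(1, 1)`, `(2, 2)` and `(4, 4)` of a standard complex Gaussian vector.
For `ξ` on one site the random variable `Y = v* ξ v` satisfies `𝔼|Y|² ≥ ‖ξ‖₂²` and
`𝔼|Y|⁴ ≤ 18 (𝔼|Y|²)²`. Both bounds tensorize, the second by the triangle inequality in `L²`, and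
`(𝔼|Y|²)³ ≤ (𝔼|Y|)² 𝔼|Y|⁴` turns them into `‖ξ‖₂² ≤ 18ᵏ (𝔼|Y|)²`; finally `‖ξ‖₁² ≤ dᵏ ‖ξ‖₂²`.
Carathéodory's theorem reduces the number of vectors to `d ^ 8`.

**De Finetti bound.** Let `Z` be the outcomes of measuring all sites of `ρ`, and let `A r` be the
mean of `-H(Z_{e_1}, …, Z_{e_r})` over random distinct sites `e`. By the tomographic inequality and
a Pinsker inequality, the mean squared distance is controlled by the mean total correlation of
`Z_{i_1}, …, Z_{i_k}` given `Z_j`, which by the chain rule is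
`(A (m + k) - A m) - k (A (m + 1) - A m)`. Given other outcomes, the outcome `c` has probability at
most `tr M_c = d q_c`, so the mean conditional relative entropy of an outcome with respect to `q` is
at most `ln d`, and all increments of `A` lie in an interval of length `ln d`. Summing over
`m = 0, …, t` then telescopes, and some `m` is at most the average.
-/

namespace DeFinetti

open Finset

/-! ### Tensor powers and the fourth moment method -/

theorem sum_fin_succ_pi {X A : Type*} [Fintype X] [AddCommMonoid A] {k : ℕ}
    (f : (Fin (k + 1) → X) → A) :
    ∑ x, f x = ∑ a, ∑ y : Fin k → X, f (Fin.cons a y) := by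
  rw [← (Fin.consEquiv fun _ => X).sum_comp, Fintype.sum_prod_type]
  rfl

theorem sum_mul_sq_sum_le_sq_sum {X Y : Type*} [Fintype X] [Fintype Y] {w : X → ℝ}
    (hw : ∀ x, 0 ≤ w x) {u : Y → ℝ} (hu : ∀ y, 0 ≤ u y) (g : X → Y → ℝ) {c : X → ℝ}
    (hc : ∀ x, 0 ≤ c x) (h : ∀ x, ∑ y, u y * g x y ^ 2 ≤ c x ^ 2) :
    ∑ y, u y * (∑ x, w x * g x y) ^ 2 ≤ (∑ x, w x * c x) ^ 2 := by
  -- the triangle inequality for the vectors `√u • g x` of a Euclidean space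
  let G : X → EuclideanSpace ℝ Y := fun x => WithLp.toLp 2 fun y => √(u y) * g x y
  have norm_G : ∀ x, ‖G x‖ ≤ c x := fun x => by
    refine (sq_le_sq₀ (norm_nonneg _) (hc x)).mp (le_trans (le_of_eq ?_) (h x))
    simp [G, EuclideanSpace.norm_sq_eq, mul_pow, Real.sq_sqrt (hu _)]
  calc ∑ y, u y * (∑ x, w x * g x y) ^ 2
      = ‖∑ x, w x • G x‖ ^ 2 := by
        simp only [EuclideanSpace.norm_sq_eq, G, WithLp.ofLp_sum, WithLp.ofLp_smul,
          Finset.sum_apply, Pi.smul_apply, smul_eq_mul, Real.norm_eq_abs, sq_abs,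
          mul_left_comm (w _), ← mul_sum, mul_pow, Real.sq_sqrt (hu _)]
    _ ≤ (∑ x, w x * c x) ^ 2 := by
        refine pow_le_pow_left₀ (norm_nonneg _) (norm_sum_le_of_le _ fun x _ => ?_) 2
        rw [norm_smul, Real.norm_of_nonneg (hw x)]
        exact mul_le_mul_of_nonneg_left (norm_G x) (hw x)

theorem cube_sum_mul_sq_le {Y : Type*} [Fintype Y] {w f : Y → ℝ} (hw : ∀ y, 0 ≤ w y)
    (hf : ∀ y, 0 ≤ f y) :
    (∑ y, w y * f y ^ 2) ^ 3 ≤ (∑ y, w y * f y) ^ 2 * ∑ y, w y * f y ^ 4 := by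
  set S : ℕ → ℝ := fun p => ∑ y, w y * f y ^ p with hS
  have S_nonneg : ∀ p, 0 ≤ S p := fun p =>
    sum_nonneg fun y _ => mul_nonneg (hw y) (pow_nonneg (hf y) p)
  have log_convex : ∀ p, S (p + 1) ^ 2 ≤ S p * S (p + 2) := fun p =>
    sum_sq_le_sum_mul_sum_of_sq_le_mul _ (fun y _ => mul_nonneg (hw y) (pow_nonneg (hf y) _))
      (fun y _ => mul_nonneg (hw y) (pow_nonneg (hf y) _)) fun y _ => le_of_eq (by ring)
  suffices S 2 ^ 3 ≤ S 1 ^ 2 * S 4 by simpa [hS] using this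
  rcases (S_nonneg 2).eq_or_lt with h0 | h0
  · rw [← h0, zero_pow three_ne_zero]
    exact mul_nonneg (sq_nonneg _) (S_nonneg 4)
  refine le_of_mul_le_mul_left ?_ h0
  calc S 2 * S 2 ^ 3 = (S 2 ^ 2) ^ 2 := by ring
    _ ≤ (S 1 * S 3) ^ 2 := pow_le_pow_left₀ (sq_nonneg _) (log_convex 1) 2
    _ = S 1 ^ 2 * S 3 ^ 2 := mul_pow _ _ _
    _ ≤ S 1 ^ 2 * (S 2 * S 4) := mul_le_mul_of_nonneg_left (log_convex 2) (sq_nonneg _)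
    _ = S 2 * (S 1 ^ 2 * S 4) := by ring

theorem sum_mul_sq_le_of_fourth_moment_le {Y : Type*} [Fintype Y] {w f : Y → ℝ}
    (hw : ∀ y, 0 ≤ w y) (hf : ∀ y, 0 ≤ f y) {C : ℝ}
    (h : ∑ y, w y * f y ^ 4 ≤ (C * ∑ y, w y * f y ^ 2) ^ 2) :
    ∑ y, w y * f y ^ 2 ≤ (C * ∑ y, w y * f y) ^ 2 := by
  have interpolation := cube_sum_mul_sq_le hw hf
  set A := ∑ y, w y * f y
  set B := ∑ y, w y * f y ^ 2
  have hB : 0 ≤ B := sum_nonneg fun y _ => mul_nonneg (hw y) (sq_nonneg _)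
  rcases hB.eq_or_lt with h0 | h0
  · rw [← h0]
    positivity
  refine le_of_mul_le_mul_left ?_ (pow_pos h0 2)
  calc B ^ 2 * B = B ^ 3 := by ring
    _ ≤ A ^ 2 * (C * B) ^ 2 :=
        interpolation.trans (mul_le_mul_of_nonneg_left h (sq_nonneg _))
    _ = B ^ 2 * (C * A) ^ 2 := by ring

section TensorPower

variable {X J R : Type*} [Fintype J] [NormedCommRing R]

/-- The `k`-th tensor power of the linear map `(J → R) → (X → R)` with the matrix `T`. -/
def tensorPower (T : X → J → R) {k : ℕ} (G : (Fin k → J) → R) (x : Fin k → X) : R :=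
  ∑ j, (∏ l, T (x l) (j l)) * G j

theorem tensorPower_cons (T : X → J → R) {k : ℕ} (G : (Fin (k + 1) → J) → R) (a : X)
    (x : Fin k → X) :
    tensorPower T G (Fin.cons a x)
      = ∑ b, T a b * tensorPower T (fun j => G (Fin.cons b j)) x := by
  simp only [tensorPower, sum_fin_succ_pi, Fin.prod_univ_succ, Fin.cons_zero, Fin.cons_succ,
    mul_sum, mul_assoc]

theorem tensorPower_cons_eq_tensorPower (T : X → J → R) {k : ℕ} (G : (Fin (k + 1) → J) → R)
    (a : X) (x : Fin k → X) :
    tensorPower T G (Fin.cons a x)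
      = tensorPower T (fun j => ∑ b, T a b * G (Fin.cons b j)) x := by
  rw [tensorPower_cons]
  simp only [tensorPower, mul_sum, mul_left_comm (T a _)]
  exact sum_comm

variable [Fintype X] {w : X → ℝ}

theorem sum_fin_succ_pi_prod_mul {k : ℕ} (F : (Fin (k + 1) → X) → ℝ) :
    ∑ x, (∏ l, w (x l)) * F x
      = ∑ x : Fin k → X, (∏ l, w (x l)) * ∑ a, w a * F (Fin.cons a x) := by
  simp only [sum_fin_succ_pi, Fin.prod_univ_succ, Fin.cons_zero, Fin.cons_succ, mul_sum]
  rw [sum_comm]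
  simp only [mul_assoc, mul_left_comm (w _)]

theorem sum_norm_sq_le_sum_norm_sq_tensorPower {T : X → J → R} (hw : ∀ x, 0 ≤ w x)
    (hT : ∀ η : J → R, ∑ j, ‖η j‖ ^ 2 ≤ ∑ x, w x * ‖∑ j, T x j * η j‖ ^ 2) :
    ∀ (k : ℕ) (G : (Fin k → J) → R),
      ∑ j, ‖G j‖ ^ 2 ≤ ∑ x : Fin k → X, (∏ l, w (x l)) * ‖tensorPower T G x‖ ^ 2
  | 0, G => by simp [tensorPower]
  | k + 1, G => by
    calc ∑ j, ‖G j‖ ^ 2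
        = ∑ b, ∑ j : Fin k → J, ‖G (Fin.cons b j)‖ ^ 2 := sum_fin_succ_pi _
      _ ≤ ∑ b, ∑ x : Fin k → X, (∏ l, w (x l)) *
            ‖tensorPower T (fun j => G (Fin.cons b j)) x‖ ^ 2 :=
          sum_le_sum fun b _ => sum_norm_sq_le_sum_norm_sq_tensorPower hw hT k _
      _ = ∑ x : Fin k → X, (∏ l, w (x l)) *
            ∑ b, ‖tensorPower T (fun j => G (Fin.cons b j)) x‖ ^ 2 := by
          rw [sum_comm]
          simp only [mul_sum]
      _ ≤ ∑ x : Fin k → X, (∏ l, w (x l)) * ∑ a, w a * ‖tensorPower T G (Fin.cons a x)‖ ^ 2 := by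
          simp only [tensorPower_cons]
          refine sum_le_sum fun x _ =>
            mul_le_mul_of_nonneg_left ?_ (prod_nonneg fun l _ => hw _)
          exact hT _
      _ = ∑ x : Fin (k + 1) → X, (∏ l, w (x l)) * ‖tensorPower T G x‖ ^ 2 := by
          rw [sum_fin_succ_pi_prod_mul]

theorem fourth_moment_tensorPower_le {T : X → J → R} (hw : ∀ x, 0 ≤ w x) {C : ℝ} (hC : 0 ≤ C)
    (hT : ∀ η : J → R, ∑ x, w x * ‖∑ j, T x j * η j‖ ^ 4
      ≤ (C * ∑ x, w x * ‖∑ j, T x j * η j‖ ^ 2) ^ 2) :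
    ∀ (k : ℕ) (G : (Fin k → J) → R),
      ∑ x : Fin k → X, (∏ l, w (x l)) * ‖tensorPower T G x‖ ^ 4
        ≤ (C ^ k * ∑ x : Fin k → X, (∏ l, w (x l)) * ‖tensorPower T G x‖ ^ 2) ^ 2
  | 0, G => by simp [tensorPower, ← pow_mul]
  | k + 1, G => by
    have hW : ∀ x : Fin k → X, 0 ≤ ∏ l, w (x l) := fun x => prod_nonneg fun l _ => hw _
    set S : X → ℝ := fun a =>
      ∑ x : Fin k → X, (∏ l, w (x l)) * ‖tensorPower T G (Fin.cons a x)‖ ^ 2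
    have induction_step : ∀ a, ∑ x : Fin k → X, (∏ l, w (x l)) *
        (‖tensorPower T G (Fin.cons a x)‖ ^ 2) ^ 2 ≤ (C ^ k * S a) ^ 2 := fun a => by
      simp only [S, ← pow_mul, tensorPower_cons_eq_tensorPower]
      exact fourth_moment_tensorPower_le hw hC hT k _
    calc ∑ x, (∏ l, w (x l)) * ‖tensorPower T G x‖ ^ 4
        = ∑ x : Fin k → X, (∏ l, w (x l)) * ∑ a, w a * ‖tensorPower T G (Fin.cons a x)‖ ^ 4 :=
          sum_fin_succ_pi_prod_mul _
      _ ≤ ∑ x : Fin k → X, (∏ l, w (x l)) *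
            (C * ∑ a, w a * ‖tensorPower T G (Fin.cons a x)‖ ^ 2) ^ 2 := by
          simp only [tensorPower_cons]
          exact sum_le_sum fun x _ => mul_le_mul_of_nonneg_left (hT _) (hW x)
      _ = C ^ 2 * ∑ x : Fin k → X, (∏ l, w (x l)) *
            (∑ a, w a * ‖tensorPower T G (Fin.cons a x)‖ ^ 2) ^ 2 := by
          simp only [mul_sum (s := univ (α := Fin k → X)), mul_pow, mul_left_comm]
      _ ≤ C ^ 2 * (∑ a, w a * (C ^ k * S a)) ^ 2 :=
          mul_le_mul_of_nonneg_left (sum_mul_sq_sum_le_sq_sum hw hW _ (fun a =>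
            mul_nonneg (pow_nonneg hC k) (sum_nonneg fun x _ => mul_nonneg (hW x) (sq_nonneg _)))
            induction_step) (sq_nonneg C)
      _ = (C ^ (k + 1) * ∑ a, w a * S a) ^ 2 := by
          simp only [mul_left_comm (w _), ← mul_sum]
          ring
      _ = (C ^ (k + 1) * ∑ x, (∏ l, w (x l)) * ‖tensorPower T G x‖ ^ 2) ^ 2 := by
          rw [sum_fin_succ_pi_prod_mul]
          simp only [S, mul_sum, mul_left_comm (w _)]
          rw [sum_comm]

theorem sum_norm_sq_le_sq_sum_norm_tensorPower {T : X → J → R} (hw : ∀ x, 0 ≤ w x) {C : ℝ}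
    (hC : 0 ≤ C) (h2 : ∀ η : J → R, ∑ j, ‖η j‖ ^ 2 ≤ ∑ x, w x * ‖∑ j, T x j * η j‖ ^ 2)
    (h4 : ∀ η : J → R, ∑ x, w x * ‖∑ j, T x j * η j‖ ^ 4
      ≤ (C * ∑ x, w x * ‖∑ j, T x j * η j‖ ^ 2) ^ 2) (k : ℕ) (G : (Fin k → J) → R) :
    ∑ j, ‖G j‖ ^ 2 ≤ (C ^ k * ∑ x : Fin k → X, (∏ l, w (x l)) * ‖tensorPower T G x‖) ^ 2 :=
  (sum_norm_sq_le_sum_norm_sq_tensorPower hw h2 k G).trans <|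
    sum_mul_sq_le_of_fourth_moment_le (fun _ => prod_nonneg fun _ _ => hw _)
      (fun _ => norm_nonneg _) (fourth_moment_tensorPower_le hw hC h4 k G)

end TensorPower

/-! ### Random vectors with the moments of a complex Gaussian vector -/

theorem star_dotProduct_mulVec_eq_sum_eigenvalues {n : Type*} [Fintype n] [DecidableEq n]
    {ξ : Matrix n n ℂ} (hξ : ξ.IsHermitian) (v : n → ℂ) :
    star v ⬝ᵥ ξ *ᵥ v = ((∑ i, hξ.eigenvalues i *
      ‖(star (hξ.eigenvectorUnitary : Matrix n n ℂ) *ᵥ v) i‖ ^ 2 : ℝ) : ℂ) := by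
  set U : Matrix n n ℂ := hξ.eigenvectorUnitary.1 with hU
  have star_vecMul : star v ᵥ* U = star (star U *ᵥ v) := by
    rw [Matrix.star_mulVec, Matrix.star_eq_conjTranspose, Matrix.conjTranspose_conjTranspose]
  conv_lhs => rw [hξ.spectral_theorem, Unitary.conjStarAlgAut_apply, ← Matrix.mulVec_mulVec,
    ← Matrix.mulVec_mulVec, Matrix.dotProduct_mulVec, ← hU, star_vecMul]
  push_cast
  refine sum_congr rfl fun i _ => ?_
  rw [Matrix.mulVec_diagonal, ← Complex.conj_mul', mul_left_comm]
  rfl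

/-- The moments of bidegree `(k, k)` of the random vector that takes the value `v x` with weight
`w x` are those of a standard complex Gaussian vector, as given by Wick's formula: the entries of
`1.submatrix b a` are the covariances of the factors. -/
def HasGaussianMoments {X : Type*} [Fintype X] {d : ℕ} (w : X → ℝ) (v : X → Fin d → ℂ)
    (k : ℕ) : Prop :=
  ∀ a b : Fin k → Fin d, ∑ x, (w x : ℂ) * ∏ l, (v x (b l) * star (v x (a l)))
    = ((1 : Matrix (Fin d) (Fin d) ℂ).submatrix b a).permanent

theorem prod_mulVec_mul_star_mulVec {d k : ℕ} (F G : Matrix (Fin k) (Fin d) ℂ) (v : Fin d → ℂ) :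
    ∏ l, ((F *ᵥ v) l * star ((G *ᵥ v) l)) = ∑ b : Fin k → Fin d, ∑ a : Fin k → Fin d,
      ((∏ l, F l (b l)) * ∏ l, star (G l (a l))) * ∏ l, (v (b l) * star (v (a l))) := by
  simp only [Matrix.mulVec, dotProduct, star_sum, star_mul', prod_mul_distrib, prod_univ_sum,
    Fintype.piFinset_univ, sum_mul_sum]
  exact sum_congr rfl fun b _ => sum_congr rfl fun a _ => by ring

theorem permanent_mul_conjTranspose {d k : ℕ} (F G : Matrix (Fin k) (Fin d) ℂ) :
    (F * Gᴴ).permanent = ∑ b : Fin k → Fin d, ∑ a : Fin k → Fin d,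
      ((∏ l, F l (b l)) * ∏ l, star (G l (a l))) *
        ((1 : Matrix (Fin d) (Fin d) ℂ).submatrix b a).permanent := by
  have reindex : ∀ σ : Equiv.Perm (Fin k), ∏ l, (F * Gᴴ) (σ l) l
      = ∑ b : Fin k → Fin d, ∑ a : Fin k → Fin d, ((∏ l, F l (b l)) * ∏ l, star (G l (a l))) *
          ∏ l, (1 : Matrix (Fin d) (Fin d) ℂ) (b (σ l)) (a l) := fun σ => by
    have entry : ∀ l, (F * Gᴴ) (σ l) l = ∑ i, ∑ j,
        F (σ l) i * star (G l j) * (1 : Matrix (Fin d) (Fin d) ℂ) i j := fun l => by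
      simp [Matrix.mul_apply, Matrix.one_apply]
    rw [← (Equiv.arrowCongr σ (Equiv.refl (Fin d))).sum_comp]
    simp only [entry, prod_univ_sum, Fintype.piFinset_univ, prod_mul_distrib]
    refine sum_congr rfl fun b _ => sum_congr rfl fun a _ => ?_
    rw [← Equiv.prod_comp σ fun l => F l (Equiv.arrowCongr σ (Equiv.refl (Fin d)) b l)]
    simp [Matrix.one_apply]
  simp only [Matrix.permanent, reindex, mul_sum, Matrix.submatrix_apply]
  rw [sum_comm]
  exact sum_congr rfl fun b _ => sum_comm

namespace HasGaussianMoments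

variable {X : Type*} [Fintype X] {d k : ℕ} {w : X → ℝ} {v : X → Fin d → ℂ}

theorem sum_mul_prod_mulVec (h : HasGaussianMoments w v k) (F G : Matrix (Fin k) (Fin d) ℂ) :
    ∑ x, (w x : ℂ) * ∏ l, ((F *ᵥ v x) l * star ((G *ᵥ v x) l)) = (F * Gᴴ).permanent := by
  simp only [prod_mulVec_mul_star_mulVec, permanent_mul_conjTranspose, ← h _ _, mul_sum,
    mul_left_comm (w _ : ℂ)]
  rw [sum_comm]
  exact sum_congr rfl fun b _ => sum_comm

theorem mulVec_unitary (h : HasGaussianMoments w v k) (U : Matrix.unitaryGroup (Fin d) ℂ) :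
    HasGaussianMoments w (fun x => U.1 *ᵥ v x) k := fun a b => by
  have covariance : U.1.submatrix b id * (U.1.submatrix a id)ᴴ
      = (1 : Matrix (Fin d) (Fin d) ℂ).submatrix b a := by
    rw [← Unitary.coe_mul_star_self U]
    rfl
  rw [← covariance, ← h.sum_mul_prod_mulVec]
  rfl

theorem sum_mul_sum_norm_sq_pow (h : HasGaussianMoments w v k) (c : Fin d → ℝ) :
    ((∑ x, w x * (∑ i, c i * ‖v x i‖ ^ 2) ^ k : ℝ) : ℂ) = ∑ a : Fin k → Fin d,
      (∏ l, (c (a l) : ℂ)) * ((1 : Matrix (Fin d) (Fin d) ℂ).submatrix a a).permanent := by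
  push_cast
  simp only [← Complex.mul_conj', Fintype.sum_pow, mul_sum, ← h _ _]
  rw [sum_comm]
  refine sum_congr rfl fun a _ => sum_congr rfl fun x _ => ?_
  rw [prod_mul_distrib]
  exact mul_left_comm _ _ _

theorem sum_mul_re_star_dotProduct_mulVec_pow (h : HasGaussianMoments w v k)
    {ξ : Matrix (Fin d) (Fin d) ℂ} (hξ : ξ.IsHermitian) {Y : Type*} [Fintype Y] {w' : Y → ℝ}
    {v' : Y → Fin d → ℂ} (h' : HasGaussianMoments w' v' k) :
    ∑ x, w x * (star (v x) ⬝ᵥ ξ *ᵥ v x).re ^ k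
      = ∑ y, w' y * (∑ i, hξ.eigenvalues i * ‖v' y i‖ ^ 2) ^ k := by
  simp only [star_dotProduct_mulVec_eq_sum_eigenvalues hξ, Complex.ofReal_re]
  have := (h.mulVec_unitary (star hξ.eigenvectorUnitary)).sum_mul_sum_norm_sq_pow hξ.eigenvalues
  rw [← h'.sum_mul_sum_norm_sq_pow] at this
  exact Complex.ofReal_injective this

end HasGaussianMoments

theorem permanent_one_submatrix {α β R : Type*} [Fintype α] [DecidableEq α] [Fintype β]
    [DecidableEq β] [CommSemiring R] (a b : α → β) :
    ((1 : Matrix β β R).submatrix b a).permanent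
      = ∏ i, if #{l | b l = i} = #{l | a l = i} then ((#{l | a l = i}).factorial : R) else 0 := by
  have permanent_eq_card : ∀ b : α → β, ((1 : Matrix β β R).submatrix b a).permanent
      = #{σ : Equiv.Perm α | b ∘ σ = a} := fun b => by
    simp only [Matrix.permanent, Matrix.submatrix_apply, Matrix.one_apply, prod_ite_zero,
      prod_const_one, mem_univ, forall_const, card_filter, funext_iff, Function.comp_apply]
    push_cast
    rfl
  rw [prod_ite_zero]
  split_ifs with hfibre
  · have τ : ∀ i, {l // a l = i} ≃ {l // b l = i} := fun i =>
      Fintype.equivOfCardEq (by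
        simpa only [Fintype.card_subtype] using (hfibre i (mem_univ i)).symm)
    have hτ : b ∘ Equiv.ofFiberEquiv τ = a := funext (Equiv.ofFiberEquiv_map τ)
    rw [← Matrix.permanent_permute_cols (Equiv.ofFiberEquiv τ), Matrix.submatrix_submatrix, hτ,
      Function.comp_id, permanent_eq_card, ← Fintype.card_subtype, DomMulAct.stabilizer_card]
    simp only [Fintype.card_subtype, Nat.cast_prod]
  · rw [permanent_eq_card, filter_false_of_mem, card_empty, Nat.cast_zero]
    rintro σ - rfl
    refine hfibre fun i _ => ?_
    simp only [← Fintype.card_subtype]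
    exact Fintype.card_congr (σ.subtypeEquiv fun l => Iff.rfl).symm

theorem hasGaussianMoments_pi {Y : Type*} [Fintype Y] {q : Y → ℝ} {c : Y → ℂ} {k : ℕ}
    (h : ∀ m ≤ k, ∀ n ≤ k, ∑ y, (q y : ℂ) * (c y ^ m * star (c y) ^ n)
      = if m = n then (n.factorial : ℂ) else 0) (d : ℕ) :
    HasGaussianMoments (fun x : Fin d → Y => ∏ i, q (x i)) (fun x i => c (x i)) k := fun a b => by
  have card_fibre_le : ∀ (e : Fin k → Fin d) i, #{l | e l = i} ≤ k := fun e i =>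
    (card_filter_le _ _).trans (card_fin k).le
  have prod_fibres : ∀ (e : Fin k → Fin d) (f : Fin d → ℂ),
      ∏ l, f (e l) = ∏ i, f i ^ #{l | e l = i} := fun e f => by
    simp only [← prod_fiberwise' univ e f, prod_const]
  calc ∑ x : Fin d → Y, ((∏ i, q (x i) : ℝ) : ℂ) * ∏ l, (c (x (b l)) * star (c (x (a l))))
      = ∑ x : Fin d → Y, ∏ i, (q (x i) : ℂ) *
          (c (x i) ^ #{l | b l = i} * star (c (x i)) ^ #{l | a l = i}) := by
        refine sum_congr rfl fun x _ => ?_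
        rw [Complex.ofReal_prod, prod_mul_distrib, prod_mul_distrib, prod_mul_distrib,
          prod_fibres b fun i => c (x i), prod_fibres a fun i => star (c (x i))]
    _ = ∏ i, ∑ y, (q y : ℂ) * (c y ^ #{l | b l = i} * star (c y) ^ #{l | a l = i}) := by
        rw [prod_univ_sum, Fintype.piFinset_univ]
    _ = ((1 : Matrix (Fin d) (Fin d) ℂ).submatrix b a).permanent := by
        rw [permanent_one_submatrix]
        exact prod_congr rfl fun i _ => h _ (card_fibre_le b i) _ (card_fibre_le a i)

theorem sum_stdAddChar_pow_mul_star_pow {N : ℕ} [NeZero N] {m n : ℕ} (hm : m < N) (hn : n < N) :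
    ∑ z : ZMod N, ZMod.stdAddChar z ^ m * star (ZMod.stdAddChar z) ^ n
      = if m = n then (N : ℂ) else 0 := by
  have character : ∀ z : ZMod N, ZMod.stdAddChar z ^ m * star (ZMod.stdAddChar z) ^ n
      = ZMod.stdAddChar (z * ((m : ZMod N) - (n : ZMod N))) := fun z => by
    rw [mul_sub, sub_eq_add_neg, AddChar.map_add_eq_mul, AddChar.map_neg_eq_conj, mul_comm z,
      mul_comm z, ← nsmul_eq_mul, ← nsmul_eq_mul, AddChar.map_nsmul_eq_pow,
      AddChar.map_nsmul_eq_pow, map_pow]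
    rfl
  have sub_eq_zero_iff : (m : ZMod N) - n = 0 ↔ m = n := by
    rw [sub_eq_zero, ZMod.natCast_eq_natCast_iff', Nat.mod_eq_of_lt hm, Nat.mod_eq_of_lt hn]
  simp only [character, AddChar.sum_mulShift _ (ZMod.isPrimitive_stdAddChar N), sub_eq_zero_iff,
    ZMod.card]
  push_cast
  rfl

/-- The Gauss-Radau quadrature for the weight `exp (-r)` with one node at `0`. -/
theorem exists_law_exponential_moments :
    ∃ p r : Fin 3 → ℝ, (∀ i, 0 ≤ p i) ∧ (∀ i, 0 ≤ r i) ∧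
      ∀ n ≤ 4, ∑ i, p i * r i ^ n = n.factorial := by
  have sq_sqrt_three : √3 ^ 2 = (3 : ℝ) := Real.sq_sqrt (by norm_num)
  have sqrt_three_le : √3 ≤ (2 : ℝ) := by nlinarith [Real.sqrt_nonneg 3]
  have sqrt_three_nonneg := Real.sqrt_nonneg 3
  refine ⟨![1 / 3, (2 + √3) / 6, (2 - √3) / 6], ![0, 3 - √3, 3 + √3], ?_, ?_, fun n hn => ?_⟩
  · rw [Fin.forall_fin_succ, Fin.forall_fin_two]
    exact ⟨by simp, by simp; linarith, by simp; linarith⟩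
  · rw [Fin.forall_fin_succ, Fin.forall_fin_two]
    exact ⟨by simp, by simp, by simp; linarith⟩
  · have pow_four : √3 ^ 4 = (9 : ℝ) := by
      rw [show √3 ^ 4 = (√3 ^ 2) ^ 2 by ring, sq_sqrt_three]
      norm_num
    rw [Fin.sum_univ_three]
    simp only [Matrix.cons_val]
    interval_cases n <;> norm_num [Nat.factorial] <;> ring_nf <;>
      norm_num [sq_sqrt_three, pow_four]

theorem exists_law_gaussian_moments :
    ∃ (q : Fin 3 × ZMod 5 → ℝ) (c : Fin 3 × ZMod 5 → ℂ), (∀ y, 0 ≤ q y) ∧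
      ∀ m ≤ 4, ∀ n ≤ 4, ∑ y, (q y : ℂ) * (c y ^ m * star (c y) ^ n)
        = if m = n then (n.factorial : ℂ) else 0 := by
  obtain ⟨p, r, hp, hr, moments⟩ := exists_law_exponential_moments
  refine ⟨fun y => p y.1 / 5, fun y => (√(r y.1) : ℂ) * ZMod.stdAddChar y.2,
    fun y => div_nonneg (hp _) (by norm_num), fun m hm n hn => ?_⟩
  have split : ∀ i : Fin 3, ∀ z : ZMod 5, ((p i / 5 : ℝ) : ℂ) *
      (((√(r i) : ℂ) * ZMod.stdAddChar z) ^ m * star ((√(r i) : ℂ) * ZMod.stdAddChar z) ^ n)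
      = (p i / 5 * √(r i) ^ (m + n) : ℝ) *
          (ZMod.stdAddChar z ^ m * star (ZMod.stdAddChar z) ^ n) := fun i z => by
    rw [star_mul', Complex.star_def, Complex.conj_ofReal]
    push_cast
    ring
  simp only [split, Fintype.sum_prod_type, ← mul_sum,
    sum_stdAddChar_pow_mul_star_pow (show m < 5 by lia) (show n < 5 by lia)]
  split_ifs with hmn
  · subst hmn
    rw [← Complex.ofReal_natCast (m.factorial), ← moments m hm]
    push_cast
    refine sum_congr rfl fun i _ => ?_
    rw [← two_mul, pow_mul, ← Complex.ofReal_pow, Real.sq_sqrt (hr i)]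
    ring
  · simp

/-! ### Second and fourth moments of quadratic forms -/

theorem sum_pi_prod_mul_sum_pow_succ {Y : Type*} [Fintype Y] (q e : Y → ℝ) {d : ℕ}
    (c : Fin (d + 1) → ℝ) (m : ℕ) :
    ∑ x : Fin (d + 1) → Y, (∏ i, q (x i)) * (∑ i, c i * e (x i)) ^ m
      = ∑ j ∈ range (m + 1), m.choose j * c 0 ^ j * (∑ y, q y * e y ^ j) *
          ∑ x : Fin d → Y, (∏ i, q (x i)) * (∑ i, c i.succ * e (x i)) ^ (m - j) := by
  simp only [sum_fin_succ_pi, Fin.prod_univ_succ, Fin.sum_univ_succ, Fin.cons_zero, Fin.cons_succ,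
    add_pow, mul_assoc, sum_mul_sum]
  simp only [mul_sum]
  rw [sum_congr rfl fun y _ => sum_comm, sum_comm]
  exact sum_congr rfl fun j _ => sum_congr rfl fun y _ => sum_congr rfl fun x _ => by ring

theorem moments_sum_mul_exponential {Y : Type*} [Fintype Y] {q e : Y → ℝ}
    (h : ∀ n ≤ 4, ∑ y, q y * e y ^ n = n.factorial) {d : ℕ} (c : Fin d → ℝ) :
    let E (m : ℕ) : ℝ := ∑ x : Fin d → Y, (∏ i, q (x i)) * (∑ i, c i * e (x i)) ^ m
    let p (m : ℕ) : ℝ := ∑ i, c i ^ m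
    E 0 = 1 ∧ E 1 = p 1 ∧ E 2 = p 1 ^ 2 + p 2 ∧ E 3 = p 1 ^ 3 + 3 * p 1 * p 2 + 2 * p 3 ∧
      E 4 = p 1 ^ 4 + 6 * p 1 ^ 2 * p 2 + 3 * p 2 ^ 2 + 8 * p 1 * p 3 + 6 * p 4 := by
  induction d with
  | zero => simp
  | succ d ih =>
    obtain ⟨h0, h1, h2, h3, h4⟩ := ih fun i => c i.succ
    dsimp only at h0 h1 h2 h3 h4 ⊢
    simp only [sum_pi_prod_mul_sum_pow_succ]
    simp only [sum_range_succ, range_zero, sum_empty, Nat.sub_zero, Nat.sub_self, Nat.reduceSub,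
      Fin.sum_univ_succ, h0, h1, h2, h3, h4, h 0 (by norm_num), h 1 (by norm_num),
      h 2 (by norm_num), h 3 (by norm_num), h 4 le_rfl]
    refine ⟨?_, ?_, ?_, ?_, ?_⟩ <;> norm_num [Nat.factorial, Nat.choose] <;> ring

theorem second_moment_sum_mul_exponential {Y : Type*} [Fintype Y] {q e : Y → ℝ}
    (h : ∀ n ≤ 4, ∑ y, q y * e y ^ n = n.factorial) {d : ℕ} (c : Fin d → ℝ) :
    ∑ x : Fin d → Y, (∏ i, q (x i)) * (∑ i, c i * e (x i)) ^ 2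
      = (∑ i, c i) ^ 2 + ∑ i, c i ^ 2 := by
  simpa only [pow_one] using (moments_sum_mul_exponential h c).2.2.1

theorem fourth_moment_sum_mul_exponential_le {Y : Type*} [Fintype Y] {q e : Y → ℝ}
    (h : ∀ n ≤ 4, ∑ y, q y * e y ^ n = n.factorial) {d : ℕ} (c : Fin d → ℝ) :
    ∑ x : Fin d → Y, (∏ i, q (x i)) * (∑ i, c i * e (x i)) ^ 4
      ≤ 18 * (∑ x : Fin d → Y, (∏ i, q (x i)) * (∑ i, c i * e (x i)) ^ 2) ^ 2 := by
  have fourth_moment := (moments_sum_mul_exponential h c).2.2.2.2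
  dsimp only at fourth_moment
  rw [fourth_moment, second_moment_sum_mul_exponential h]
  simp only [pow_one]
  set a := ∑ i, c i
  have odd_powers : 8 * a * ∑ i, c i ^ 3 ≤ 4 * (a ^ 2 * ∑ i, c i ^ 2 + ∑ i, c i ^ 4) := by
    simp only [mul_sum, ← sum_add_distrib]
    exact sum_le_sum fun i _ => by nlinarith [sq_nonneg (a * c i - c i ^ 2)]
  have fourth_powers : ∑ i, c i ^ 4 ≤ (∑ i, c i ^ 2) ^ 2 := by
    simpa only [← pow_mul] using
      sum_sq_le_sq_sum_of_nonneg (s := univ) (f := fun i => c i ^ 2) fun i _ => sq_nonneg _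
  have : 0 ≤ a ^ 2 * ∑ i, c i ^ 2 :=
    mul_nonneg (sq_nonneg _) (sum_nonneg fun i _ => sq_nonneg _)
  nlinarith [sq_nonneg (a ^ 2), sq_nonneg (∑ i, c i ^ 2)]

theorem trace_conjTranspose_mul_self_eq_sum_norm_sq {m n : Type*} [Fintype m] [Fintype n]
    (A : Matrix m n ℂ) : (Aᴴ * A).trace = ((∑ p : m × n, ‖A p.1 p.2‖ ^ 2 : ℝ) : ℂ) := by
  push_cast
  simp only [Matrix.trace, Matrix.diag, Matrix.mul_apply, Matrix.conjTranspose_apply,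
    Complex.star_def, Complex.conj_mul', Fintype.sum_prod_type]
  exact sum_comm

theorem sum_eigenvalues_sq_eq_sum_norm_sq {n : Type*} [Fintype n] [DecidableEq n]
    {ξ : Matrix n n ℂ} (hξ : ξ.IsHermitian) :
    ∑ i, hξ.eigenvalues i ^ 2 = ∑ p : n × n, ‖ξ p.1 p.2‖ ^ 2 := by
  apply Complex.ofReal_injective
  rw [← trace_conjTranspose_mul_self_eq_sum_norm_sq, hξ.eq]
  conv_rhs => rw [hξ.spectral_theorem, ← map_mul, Unitary.conjStarAlgAut_apply,
    Matrix.trace_mul_cycle, Unitary.coe_star_mul_self, one_mul, Matrix.diagonal_mul_diagonal,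
    Matrix.trace_diagonal]
  push_cast
  exact sum_congr rfl fun i _ => pow_two _

section QuadraticForm

variable {X : Type*} [Fintype X] {d : ℕ} {w : X → ℝ} {v : X → Fin d → ℂ}
  {ξ : Matrix (Fin d) (Fin d) ℂ}

/-- By unitary invariance, `v* ξ v` is distributed as the combination of independent exponential
variables `‖v i‖ ^ 2` with the eigenvalues of `ξ` as coefficients, as far as moments go. -/
theorem exists_exponential_moments_eq (hξ : ξ.IsHermitian) (w : X → ℝ) (v : X → Fin d → ℂ) :
    ∃ q e : Fin 3 × ZMod 5 → ℝ, (∀ n ≤ 4, ∑ y, q y * e y ^ n = n.factorial) ∧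
      ∀ k ≤ 4, HasGaussianMoments w v k → ∑ x, w x * (star (v x) ⬝ᵥ ξ *ᵥ v x).re ^ k
        = ∑ x : Fin d → Fin 3 × ZMod 5, (∏ i, q (x i)) * (∑ i, hξ.eigenvalues i * e (x i)) ^ k := by
  obtain ⟨q, c, -, moments⟩ := exists_law_gaussian_moments
  refine ⟨q, fun y => ‖c y‖ ^ 2, fun n hn => ?_, fun k hk h => ?_⟩
  · have := moments n hn n hn
    simp only [← mul_pow, Complex.star_def, Complex.mul_conj', if_true] at this
    exact_mod_cast this
  · exact h.sum_mul_re_star_dotProduct_mulVec_pow hξ <|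
      hasGaussianMoments_pi (fun m hm n hn => moments m (hm.trans hk) n (hn.trans hk)) d

namespace HasGaussianMoments

theorem sum_norm_sq_le_second_moment_re (h2 : HasGaussianMoments w v 2) (hξ : ξ.IsHermitian) :
    ∑ p : Fin d × Fin d, ‖ξ p.1 p.2‖ ^ 2 ≤ ∑ x, w x * (star (v x) ⬝ᵥ ξ *ᵥ v x).re ^ 2 := by
  obtain ⟨q, e, moments, eq_moment⟩ := exists_exponential_moments_eq hξ w v
  rw [eq_moment 2 (by norm_num) h2, second_moment_sum_mul_exponential moments,
    ← sum_eigenvalues_sq_eq_sum_norm_sq hξ]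
  exact le_add_of_nonneg_left (sq_nonneg _)

theorem fourth_moment_re_le (h2 : HasGaussianMoments w v 2) (h4 : HasGaussianMoments w v 4)
    (hξ : ξ.IsHermitian) : ∑ x, w x * (star (v x) ⬝ᵥ ξ *ᵥ v x).re ^ 4
      ≤ 18 * (∑ x, w x * (star (v x) ⬝ᵥ ξ *ᵥ v x).re ^ 2) ^ 2 := by
  obtain ⟨q, e, moments, eq_moment⟩ := exists_exponential_moments_eq hξ w v
  rw [eq_moment 2 (by norm_num) h2, eq_moment 4 le_rfl h4]
  exact fourth_moment_sum_mul_exponential_le moments _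

end HasGaussianMoments

open scoped ComplexStarModule

theorem norm_sq_star_dotProduct_mulVec {n : Type*} [Fintype n] (ξ : Matrix n n ℂ) (v : n → ℂ) :
    ‖star v ⬝ᵥ ξ *ᵥ v‖ ^ 2 = (star v ⬝ᵥ (ℜ ξ : Matrix n n ℂ) *ᵥ v).re ^ 2
      + (star v ⬝ᵥ (ℑ ξ : Matrix n n ℂ) *ᵥ v).re ^ 2 := by
  have im_eq_zero : ∀ A : selfAdjoint (Matrix n n ℂ),
      (star v ⬝ᵥ (A : Matrix n n ℂ) *ᵥ v).im = 0 := fun A =>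
    Matrix.IsHermitian.im_star_dotProduct_mulVec_self A.2 v
  conv_lhs => rw [← realPart_add_I_smul_imaginaryPart ξ, Matrix.add_mulVec, dotProduct_add,
    Matrix.smul_mulVec, dotProduct_smul, Complex.sq_norm, Complex.normSq_apply]
  simp [im_eq_zero, pow_two]

theorem sum_norm_sq_eq_add {n : Type*} [Fintype n] (ξ : Matrix n n ℂ) :
    ∑ p : n × n, ‖ξ p.1 p.2‖ ^ 2 = ∑ p : n × n, ‖(ℜ ξ : Matrix n n ℂ) p.1 p.2‖ ^ 2
      + ∑ p : n × n, ‖(ℑ ξ : Matrix n n ℂ) p.1 p.2‖ ^ 2 := by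
  apply Complex.ofReal_injective
  rw [Complex.ofReal_add]
  simp only [← trace_conjTranspose_mul_self_eq_sum_norm_sq]
  have hA : (ℜ ξ : Matrix n n ℂ)ᴴ = ℜ ξ := (ℜ ξ).2
  have hB : (ℑ ξ : Matrix n n ℂ)ᴴ = ℑ ξ := (ℑ ξ).2
  conv_lhs => rw [← realPart_add_I_smul_imaginaryPart ξ]
  simp only [Matrix.conjTranspose_add, Matrix.conjTranspose_smul, hA, hB, add_mul, mul_add,
    Matrix.trace_add, Matrix.smul_mul, Matrix.mul_smul, Matrix.trace_smul, smul_eq_mul,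
    Complex.star_def, Complex.conj_I]
  linear_combination -((ℑ ξ : Matrix n n ℂ) * ℑ ξ).trace * Complex.I_mul_I
    + Complex.I * Matrix.trace_mul_comm (ℜ ξ : Matrix n n ℂ) (ℑ ξ)

namespace HasGaussianMoments

theorem sum_norm_sq_le_second_moment (h2 : HasGaussianMoments w v 2)
    (ξ : Matrix (Fin d) (Fin d) ℂ) :
    ∑ p : Fin d × Fin d, ‖ξ p.1 p.2‖ ^ 2 ≤ ∑ x, w x * ‖star (v x) ⬝ᵥ ξ *ᵥ v x‖ ^ 2 := by
  simp only [norm_sq_star_dotProduct_mulVec, mul_add, sum_add_distrib, sum_norm_sq_eq_add ξ]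
  exact add_le_add (h2.sum_norm_sq_le_second_moment_re (ℜ ξ).2)
    (h2.sum_norm_sq_le_second_moment_re (ℑ ξ).2)

theorem fourth_moment_le (hw : ∀ x, 0 ≤ w x) (h2 : HasGaussianMoments w v 2)
    (h4 : HasGaussianMoments w v 4) (ξ : Matrix (Fin d) (Fin d) ℂ) :
    ∑ x, w x * ‖star (v x) ⬝ᵥ ξ *ᵥ v x‖ ^ 4
      ≤ (√18 * ∑ x, w x * ‖star (v x) ⬝ᵥ ξ *ᵥ v x‖ ^ 2) ^ 2 := by
  let part : Fin 2 → Matrix (Fin d) (Fin d) ℂ := ![ℜ ξ, ℑ ξ]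
  have part_isHermitian : ∀ s, (part s).IsHermitian := Fin.forall_fin_two.2 ⟨(ℜ ξ).2, (ℑ ξ).2⟩
  have norm_sq : ∀ x, ‖star (v x) ⬝ᵥ ξ *ᵥ v x‖ ^ 2
      = ∑ s, 1 * (star (v x) ⬝ᵥ part s *ᵥ v x).re ^ 2 := fun x => by
    rw [norm_sq_star_dotProduct_mulVec, Fin.sum_univ_two, one_mul, one_mul]
    rfl
  calc ∑ x, w x * ‖star (v x) ⬝ᵥ ξ *ᵥ v x‖ ^ 4
      = ∑ x, w x * (∑ s, 1 * (star (v x) ⬝ᵥ part s *ᵥ v x).re ^ 2) ^ 2 := by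
        simp only [← norm_sq, ← pow_mul]
    _ ≤ (∑ s, 1 * (√18 * ∑ x, w x * (star (v x) ⬝ᵥ part s *ᵥ v x).re ^ 2)) ^ 2 := by
        refine sum_mul_sq_sum_le_sq_sum (fun _ => zero_le_one) hw _ (fun s =>
          mul_nonneg (Real.sqrt_nonneg _) (sum_nonneg fun x _ => mul_nonneg (hw x) (sq_nonneg _)))
          fun s => ?_
        rw [mul_pow, Real.sq_sqrt (by norm_num)]
        simpa only [← pow_mul] using h2.fourth_moment_re_le h4 (part_isHermitian s)
    _ = (√18 * ∑ x, w x * ‖star (v x) ⬝ᵥ ξ *ᵥ v x‖ ^ 2) ^ 2 := by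
        simp only [norm_sq, one_mul, ← mul_sum, sum_comm (s := univ (α := Fin 2))]

end HasGaussianMoments

end QuadraticForm

/-! ### Reducing the number of vectors -/

theorem exists_fin_weights_sum_smul_eq {X E : Type*} [Fintype X] [AddCommGroup E] [Module ℝ E]
    [FiniteDimensional ℝ E] {w : X → ℝ} (hw : ∀ x, 0 ≤ w x) (hw1 : ∑ x, w x = 1) (f : X → E) :
    ∃ (N : ℕ) (x : Fin N → X) (w' : Fin N → ℝ), N ≤ Module.finrank ℝ E + 1 ∧ (∀ i, 0 ≤ w' i) ∧
      ∑ i, w' i • f (x i) = ∑ x, w x • f x := by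
  have mem_convexHull : ∑ x, w x • f x ∈ convexHull ℝ (Set.range f) :=
    (convex_convexHull ℝ _).sum_mem (fun x _ => hw x) hw1
      fun x _ => subset_convexHull ℝ _ (Set.mem_range_self x)
  obtain ⟨ι, _, y, w', y_mem, independent, w'_pos, -, sum_eq⟩ :=
    eq_pos_convex_span_of_mem_convexHull mem_convexHull
  choose x hx using fun i => y_mem (Set.mem_range_self i)
  let e := Fintype.equivFin ι
  refine ⟨Fintype.card ι, x ∘ e.symm, w' ∘ e.symm, ?_, fun i => (w'_pos _).le, ?_⟩
  · exact independent.card_le_finrank_succ.trans (Nat.succ_le_succ (Submodule.finrank_le _))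
  · simp only [Function.comp_apply, hx, ← sum_eq]
    exact e.symm.sum_comp fun i => w' i • y i

/-- The monomials of the bidegrees `(K t, K t)` in `z` and `star z`. A monomial of degree `k` in `d`
variables is encoded by the multiset of its variables. -/
def bidegreeMonomials {ι : Type*} (K : ι → ℕ) {d : ℕ} (z : Fin d → ℂ) :
    (Σ t, Sym (Fin d) (K t) × Sym (Fin d) (K t)) → ℂ :=
  fun s => (s.2.1.1.map z).prod * (s.2.2.1.map (star z)).prod

theorem HasGaussianMoments.of_sum_smul_bidegreeMonomials_eq {X Y ι : Type*} [Fintype X]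
    [Fintype Y] {d : ℕ} {w : X → ℝ} {v : X → Fin d → ℂ} {w' : Y → ℝ} {v' : Y → Fin d → ℂ}
    {K : ι → ℕ} (h : ∑ y, w' y • bidegreeMonomials K (v' y) = ∑ x, w x • bidegreeMonomials K (v x))
    {t : ι} (hG : HasGaussianMoments w v (K t)) : HasGaussianMoments w' v' (K t) := fun a b => by
  let monomial (e : Fin (K t) → Fin d) : Sym (Fin d) (K t) := ⟨univ.val.map e, by simp⟩
  have prod_eq : ∀ z : Fin d → ℂ, ∏ l, (z (b l) * star (z (a l)))
      = bidegreeMonomials K z ⟨t, monomial b, monomial a⟩ := fun z => by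
    simp only [bidegreeMonomials, monomial, Multiset.map_map, prod_mul_distrib]
    rfl
  rw [← hG a b]
  simpa only [prod_eq, Finset.sum_apply, Pi.smul_apply, Complex.real_smul]
    using congrFun h ⟨t, monomial b, monomial a⟩

theorem exists_fin_hasGaussianMoments {ι : Type*} [Fintype ι] {K : ι → ℕ} (hK : ∀ t, K t ≤ 4)
    (d : ℕ) : ∃ (N : ℕ) (w : Fin N → ℝ) (v : Fin N → Fin d → ℂ),
      N ≤ 2 * ∑ t, Fintype.card (Sym (Fin d) (K t)) ^ 2 + 1 ∧ (∀ x, 0 ≤ w x) ∧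
        ∀ t, HasGaussianMoments w v (K t) := by
  obtain ⟨q, c, hq, moments⟩ := exists_law_gaussian_moments
  have gaussian : ∀ k ≤ 4, HasGaussianMoments (fun x : Fin d → Fin 3 × ZMod 5 => ∏ i, q (x i))
      (fun x i => c (x i)) k := fun k hk =>
    hasGaussianMoments_pi (fun m hm n hn => moments m (hm.trans hk) n (hn.trans hk)) d
  have total_weight : ∑ x : Fin d → Fin 3 × ZMod 5, ∏ i, q (x i) = 1 := by
    have := gaussian 0 (by norm_num) Fin.elim0 Fin.elim0
    simp only [univ_eq_empty, prod_empty, mul_one, Matrix.permanent_isEmpty] at this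
    exact_mod_cast this
  obtain ⟨N, x, w, card_le, w_nonneg, sum_eq⟩ := exists_fin_weights_sum_smul_eq
    (fun x => prod_nonneg fun i _ => hq (x i)) total_weight
    fun x => bidegreeMonomials K fun i => c (x i)
  refine ⟨N, w, fun y i => c (x y i), card_le.trans_eq ?_, w_nonneg, fun t =>
    .of_sum_smul_bidegreeMonomials_eq sum_eq (gaussian _ (hK t))⟩
  rw [finrank_real_of_complex, Module.finrank_fintype_fun_eq_card, Fintype.card_sigma]
  simp only [Fintype.card_prod, pow_two]

theorem factorial_mul_card_sym (d k : ℕ) :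
    k.factorial * Fintype.card (Sym (Fin d) k) = d.ascFactorial k := by
  rw [Sym.card_sym_eq_multichoose, Nat.multichoose_eq, Fintype.card_fin,
    Nat.ascFactorial_eq_factorial_mul_choose']

theorem two_mul_sum_card_sym_sq_lt {d : ℕ} (hd : 2 ≤ d) :
    2 * ∑ t, Fintype.card (Sym (Fin d) (![1, 2, 4] t)) ^ 2 < d ^ 8 := by
  have card_one : Fintype.card (Sym (Fin d) 1) = d := by
    simpa [Nat.ascFactorial] using factorial_mul_card_sym d 1
  have card_two : Fintype.card (Sym (Fin d) 2) ≤ d ^ 2 := by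
    have := factorial_mul_card_sym d 2
    simp only [Nat.ascFactorial, Nat.factorial] at this
    nlinarith
  have card_four : 2 * Fintype.card (Sym (Fin d) 4) ≤ d ^ 4 := by
    have := factorial_mul_card_sym d 4
    simp only [Nat.ascFactorial, Nat.factorial] at this
    have : (d + 3) * ((d + 2) * ((d + 1) * (d + 0))) ≤ 3 * d * (2 * d * (2 * d * d)) := by
      gcongr <;> lia
    nlinarith
  rw [Fin.sum_univ_three]
  change 2 * (Fintype.card (Sym (Fin d) 1) ^ 2 + Fintype.card (Sym (Fin d) 2) ^ 2
    + Fintype.card (Sym (Fin d) 4) ^ 2) < d ^ 8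
  rw [card_one]
  have sq_card_two := Nat.pow_le_pow_left card_two 2
  have sq_card_four := Nat.pow_le_pow_left card_four 2
  have four_le_sq : 4 ≤ d ^ 2 := Nat.pow_le_pow_left hd 2
  have sixteen_le_pow : 16 ≤ d ^ 4 := Nat.pow_le_pow_left hd 4
  ring_nf at *
  nlinarith

/-! ### Existence of a tomographic measurement -/

section TraceNorm

variable {β : Type} [Fintype β] [DecidableEq β]

theorem traceNorm_nonneg (A : Matrix β β ℂ) : 0 ≤ traceNorm A :=
  sum_nonneg fun _ _ => Real.sqrt_nonneg _

theorem traceNorm_sq_le_card_mul_sum_norm_sq (A : Matrix β β ℂ) :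
    traceNorm A ^ 2 ≤ Fintype.card β * ∑ p : β × β, ‖A p.1 p.2‖ ^ 2 := by
  have hA := Matrix.isHermitian_conjTranspose_mul_self A
  have sum_eigenvalues : ∑ b, hA.eigenvalues b = ∑ p : β × β, ‖A p.1 p.2‖ ^ 2 := by
    apply Complex.ofReal_injective
    rw [← trace_conjTranspose_mul_self_eq_sum_norm_sq, hA.trace_eq_sum_eigenvalues,
      Complex.ofReal_sum]
    rfl
  calc traceNorm A ^ 2 ≤ Fintype.card β * ∑ b, √(hA.eigenvalues b) ^ 2 := sq_sum_le_card_mul_sum_sq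
    _ = Fintype.card β * ∑ p : β × β, ‖A p.1 p.2‖ ^ 2 := by
      rw [← sum_eigenvalues]
      exact congrArg _ <| sum_congr rfl fun b _ =>
        Real.sq_sqrt (Matrix.eigenvalues_conjTranspose_mul_self_nonneg A b)

theorem traceNorm_eq_zero_of_trace_eq_zero [Unique β] {A : Matrix β β ℂ} (hA : A.trace = 0) :
    traceNorm A = 0 := by
  have : A = 0 := by
    ext a b
    rw [Unique.eq_default a, Unique.eq_default b]
    simpa [Matrix.trace] using hA
  simpa [this] using (traceNorm_sq_le_card_mul_sum_norm_sq A).antisymm (by simp [this, sq_nonneg])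

end TraceNorm

theorem one_div_rpow_half_mul_le_iff {x a b : ℝ} (hx : 0 < x) (ha : 0 ≤ a) (hb : 0 ≤ b) (k : ℕ) :
    1 / x ^ ((k : ℝ) / 2) * a ≤ b ↔ a ^ 2 ≤ x ^ k * b ^ 2 := by
  have rpow_pos : 0 < x ^ ((k : ℝ) / 2) := Real.rpow_pos_of_pos hx _
  have rpow_sq : (x ^ ((k : ℝ) / 2)) ^ 2 = x ^ k := by
    rw [← Real.rpow_mul_natCast hx.le, Nat.cast_two, div_mul_cancel₀ _ two_ne_zero,
      Real.rpow_natCast]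
  rw [one_div, inv_mul_le_iff₀ rpow_pos, ← sq_le_sq₀ ha (mul_nonneg rpow_pos.le hb), mul_pow,
    rpow_sq]

theorem Measurement.isTomographic_iff {d N : ℕ} (hd : 0 < d) {M : Measurement d N} :
    M.IsTomographic ↔ N ≤ d ^ 8 ∧ ∀ k, 0 < k → ∀ ξ : QuditOp d (Fin k), ξ.trace = 0 →
      traceNorm ξ ^ 2 ≤ (18 * (d : ℝ)) ^ k * (∑ x, ‖M.apply ξ x‖) ^ 2 :=
  and_congr_right fun _ => forall_congr' fun k => forall_congr' fun _ => forall_congr' fun ξ =>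
    forall_congr' fun _ => one_div_rpow_half_mul_le_iff (by positivity) (traceNorm_nonneg ξ)
      (sum_nonneg fun _ _ => norm_nonneg _) k

section RankOne

variable {d N : ℕ} {w : Fin N → ℝ} {v : Fin N → Fin d → ℂ}

/-- The measurement whose effects are the rank one operators `w x • v x (v x)*`. -/
def rankOneMeasurement (hw : ∀ x, 0 ≤ w x) (h : HasGaussianMoments w v 1) : Measurement d N where
  effect x := (w x : ℂ) • Matrix.vecMulVec (v x) (star (v x))
  posSemidef x := (Matrix.posSemidef_vecMulVec_self_star (v x)).smul (by exact_mod_cast hw x)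
  sum_eq_one := by
    ext i j
    have := h (fun _ => j) fun _ => i
    rw [Matrix.permanent_unique] at this
    simpa [Matrix.sum_apply, Matrix.vecMulVec_apply] using this

theorem rankOneMeasurement_apply (hw : ∀ x, 0 ≤ w x) (h : HasGaussianMoments w v 1) {k : ℕ}
    (ξ : QuditOp d (Fin k)) (x : Fin k → Fin N) :
    (rankOneMeasurement hw h).apply ξ x = (∏ l, (w (x l) : ℂ)) *
      tensorPower (fun x (p : Fin d × Fin d) => star (v x p.1) * v x p.2)
        (fun p => ξ (fun l => (p l).1) fun l => (p l).2) x := by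
  rw [Measurement.apply, Matrix.trace_mul_comm, tensorPower,
    ← (Equiv.arrowProdEquivProdArrow _ _ _).symm.sum_comp, Fintype.sum_prod_type, Matrix.trace,
    mul_sum]
  refine sum_congr rfl fun a _ => ?_
  rw [Matrix.diag_apply, Matrix.mul_apply, mul_sum]
  refine sum_congr rfl fun b _ => ?_
  simp only [tensorOp, Matrix.of_apply, rankOneMeasurement, Matrix.smul_apply,
    Matrix.vecMulVec_apply, Pi.star_apply, smul_eq_mul, prod_mul_distrib,
    Equiv.arrowProdEquivProdArrow, Equiv.coe_fn_symm_mk]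
  ring

theorem sum_norm_sq_le_sq_sum_norm_rankOneMeasurement_apply (hw : ∀ x, 0 ≤ w x)
    (h1 : HasGaussianMoments w v 1) (h2 : HasGaussianMoments w v 2)
    (h4 : HasGaussianMoments w v 4) {k : ℕ} (ξ : QuditOp d (Fin k)) :
    ∑ p : (Fin k → Fin d) × (Fin k → Fin d), ‖ξ p.1 p.2‖ ^ 2
      ≤ 18 ^ k * (∑ x, ‖(rankOneMeasurement hw h1).apply ξ x‖) ^ 2 := by
  have quadratic_form : ∀ (x : Fin N) (η : Fin d × Fin d → ℂ),
      ∑ p : Fin d × Fin d, star (v x p.1) * v x p.2 * η p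
        = star (v x) ⬝ᵥ Matrix.of (fun i j => η (i, j)) *ᵥ v x := fun x η => by
    simp only [Fintype.sum_prod_type, dotProduct, Matrix.mulVec, mul_sum, Matrix.of_apply,
      Pi.star_apply, mul_assoc, mul_comm (v x _)]
  have norm_apply : ∀ x, ‖(rankOneMeasurement hw h1).apply ξ x‖ = (∏ l, w (x l)) *
      ‖tensorPower (fun x (p : Fin d × Fin d) => star (v x p.1) * v x p.2)
        (fun p => ξ (fun l => (p l).1) fun l => (p l).2) x‖ := fun x => by
    rw [rankOneMeasurement_apply, norm_mul, ← Complex.ofReal_prod, Complex.norm_of_nonneg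
      (prod_nonneg fun l _ => hw _)]
  have constant : (18 : ℝ) ^ k = (√18 ^ k) ^ 2 := by
    rw [← pow_mul, mul_comm, pow_mul, Real.sq_sqrt (by norm_num)]
  simp only [norm_apply, constant, ← mul_pow]
  rw [← (Equiv.arrowProdEquivProdArrow _ _ _).sum_comp]
  refine sum_norm_sq_le_sq_sum_norm_tensorPower hw (Real.sqrt_nonneg 18) (fun η => ?_)
    (fun η => ?_) k fun p : Fin k → Fin d × Fin d => ξ (fun l => (p l).1) fun l => (p l).2
  · simp only [quadratic_form]
    exact h2.sum_norm_sq_le_second_moment (Matrix.of fun i j => η (i, j))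
  · simp only [quadratic_form]
    exact h2.fourth_moment_le hw h4 _

theorem rankOneMeasurement_isTomographic (hd : 0 < d) (hN : N ≤ d ^ 8) (hw : ∀ x, 0 ≤ w x)
    (h1 : HasGaussianMoments w v 1) (h2 : HasGaussianMoments w v 2)
    (h4 : HasGaussianMoments w v 4) : (rankOneMeasurement hw h1).IsTomographic := by
  refine (Measurement.isTomographic_iff hd).2 ⟨hN, fun k _ ξ _ => ?_⟩
  calc traceNorm ξ ^ 2
      ≤ (d : ℝ) ^ k * ∑ p : (Fin k → Fin d) × (Fin k → Fin d), ‖ξ p.1 p.2‖ ^ 2 := by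
        simpa using traceNorm_sq_le_card_mul_sum_norm_sq ξ
    _ ≤ (d : ℝ) ^ k * (18 ^ k * (∑ x, ‖(rankOneMeasurement hw h1).apply ξ x‖) ^ 2) := by
        gcongr
        exact sum_norm_sq_le_sq_sum_norm_rankOneMeasurement_apply hw h1 h2 h4 ξ
    _ = (18 * (d : ℝ)) ^ k * (∑ x, ‖(rankOneMeasurement hw h1).apply ξ x‖) ^ 2 := by
        rw [mul_pow]
        ring

end RankOne

/-- The measurement with a single outcome. -/
def trivialMeasurement (d : ℕ) : Measurement d 1 where
  effect _ := 1
  posSemidef _ := Matrix.PosSemidef.one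
  sum_eq_one := by simp

theorem trivialMeasurement_one_isTomographic : (trivialMeasurement 1).IsTomographic := by
  refine ⟨by norm_num, fun k _ ξ hξ => ?_⟩
  rw [traceNorm_eq_zero_of_trace_eq_zero hξ, mul_zero]
  exact sum_nonneg fun x _ => norm_nonneg _

theorem exists_isTomographic {d : ℕ} (hd : 0 < d) :
    ∃ (N : ℕ) (M : Measurement d N), M.IsTomographic := by
  rcases Nat.eq_or_lt_of_le (Nat.succ_le_of_lt hd) with rfl | two_le
  · exact ⟨1, _, trivialMeasurement_one_isTomographic⟩
  obtain ⟨N, w, v, card_le, hw, gaussian⟩ :=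
    exists_fin_hasGaussianMoments (K := ![1, 2, 4]) (by decide) d
  exact ⟨N, _, rankOneMeasurement_isTomographic hd
    (card_le.trans (Nat.succ_le_of_lt (two_mul_sum_card_sym_sq_lt two_le))) hw (gaussian 0)
    (gaussian 1) (gaussian 2)⟩

/-! ### Relative entropy and the ℓ¹ distance -/

section RelativeEntropy

theorem sub_le_mul_log_sub_log {r s : ℝ} (hr : 0 ≤ r) (hs : 0 ≤ s) (hrs : s = 0 → r = 0) :
    r - s ≤ r * (Real.log r - Real.log s) := by
  rcases hr.eq_or_lt with rfl | hr
  · simpa using hs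
  have hs : 0 < s := hs.lt_of_ne' fun h => hr.ne' (hrs h)
  have := mul_le_mul_of_nonneg_left (Real.log_le_sub_one_of_pos (div_pos hs hr)) hr.le
  rw [Real.log_div hs.ne' hr.ne', mul_sub, mul_sub, mul_div_cancel₀ _ hr.ne'] at this
  linarith

theorem two_mul_sub_sqrt_mul_sqrt_le_mul_log_sub_log {r s : ℝ} (hr : 0 ≤ r) (hs : 0 ≤ s)
    (hrs : s = 0 → r = 0) : 2 * (r - √r * √s) ≤ r * (Real.log r - Real.log s) := by
  have h := sub_le_mul_log_sub_log (Real.sqrt_nonneg r) (Real.sqrt_nonneg s) fun h => by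
    rw [Real.sqrt_eq_zero hs] at h
    rw [hrs h, Real.sqrt_zero]
  rw [Real.log_sqrt hr, Real.log_sqrt hs] at h
  calc 2 * (r - √r * √s) = 2 * (√r * (√r - √s)) := by
        linear_combination -2 * Real.mul_self_sqrt hr
    _ ≤ 2 * (√r * (√r * (Real.log r / 2 - Real.log s / 2))) := by gcongr
    _ = √r * √r * (Real.log r - Real.log s) := by ring
    _ = r * (Real.log r - Real.log s) := by rw [Real.mul_self_sqrt hr]

variable {α : Type*} [Fintype α] {r s : α → ℝ}

theorem sum_mul_log_le_sum_mul_log (hr : ∀ a, 0 ≤ r a) (hs : ∀ a, 0 ≤ s a)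
    (hsr : ∑ a, s a ≤ ∑ a, r a) (hrs : ∀ a, s a = 0 → r a = 0) :
    ∑ a, r a * Real.log (s a) ≤ ∑ a, r a * Real.log (r a) := by
  have h := sum_le_sum fun a (_ : a ∈ univ) => sub_le_mul_log_sub_log (hr a) (hs a) (hrs a)
  simp only [mul_sub, sum_sub_distrib] at h
  linarith

theorem sq_sum_abs_sub_le_four_mul_sum_sq_sqrt_sub_sqrt (hr : ∀ a, 0 ≤ r a) (hs : ∀ a, 0 ≤ s a)
    (hr1 : ∑ a, r a = 1) (hs1 : ∑ a, s a = 1) :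
    (∑ a, |r a - s a|) ^ 2 ≤ 4 * ∑ a, (√(r a) - √(s a)) ^ 2 := by
  have factor : ∀ a, |r a - s a| = |√(r a) - √(s a)| * (√(r a) + √(s a)) := fun a => by
    rw [← abs_of_nonneg (show 0 ≤ √(r a) + √(s a) by positivity), ← abs_mul]
    congr 1
    linear_combination Real.sq_sqrt (hs a) - Real.sq_sqrt (hr a)
  have sum_sq_add : ∑ a, (√(r a) + √(s a)) ^ 2 ≤ 4 := by
    calc ∑ a, (√(r a) + √(s a)) ^ 2 ≤ ∑ a, 2 * (√(r a) ^ 2 + √(s a) ^ 2) :=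
          sum_le_sum fun a _ => add_sq_le
      _ = 2 * (∑ a, r a + ∑ a, s a) := by
          simp only [Real.sq_sqrt (hr _), Real.sq_sqrt (hs _), ← mul_sum, sum_add_distrib]
      _ = 4 := by rw [hr1, hs1]; norm_num
  calc (∑ a, |r a - s a|) ^ 2
      ≤ (∑ a, |√(r a) - √(s a)| ^ 2) * ∑ a, (√(r a) + √(s a)) ^ 2 := by
        simp only [factor]
        exact sum_mul_sq_le_sq_mul_sq _ _ _
    _ ≤ (∑ a, (√(r a) - √(s a)) ^ 2) * 4 := by
        simp only [sq_abs]
        gcongr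
    _ = 4 * ∑ a, (√(r a) - √(s a)) ^ 2 := mul_comm _ _

theorem sum_sq_sqrt_sub_sqrt_le_sum_mul_log_sub_log (hr : ∀ a, 0 ≤ r a) (hs : ∀ a, 0 ≤ s a)
    (hsr : ∑ a, s a = ∑ a, r a) (hrs : ∀ a, s a = 0 → r a = 0) :
    ∑ a, (√(r a) - √(s a)) ^ 2 ≤ ∑ a, r a * (Real.log (r a) - Real.log (s a)) := by
  calc ∑ a, (√(r a) - √(s a)) ^ 2
      = ∑ a, (2 * (r a - √(r a) * √(s a)) + (s a - r a)) := sum_congr rfl fun a _ => by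
        linear_combination Real.sq_sqrt (hs a) + Real.sq_sqrt (hr a)
    _ = ∑ a, 2 * (r a - √(r a) * √(s a)) := by
        rw [sum_add_distrib, sum_sub_distrib (fun a => s a), hsr, sub_self, add_zero]
    _ ≤ ∑ a, r a * (Real.log (r a) - Real.log (s a)) := sum_le_sum fun a _ =>
        two_mul_sub_sqrt_mul_sqrt_le_mul_log_sub_log (hr a) (hs a) (hrs a)

theorem sq_sum_abs_sub_le_four_mul_sum_mul_log_sub_log (hr : ∀ a, 0 ≤ r a) (hs : ∀ a, 0 ≤ s a)
    (hr1 : ∑ a, r a = 1) (hs1 : ∑ a, s a = 1) (hrs : ∀ a, s a = 0 → r a = 0) :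
    (∑ a, |r a - s a|) ^ 2 ≤ 4 * ∑ a, r a * (Real.log (r a) - Real.log (s a)) :=
  (sq_sum_abs_sub_le_four_mul_sum_sq_sqrt_sub_sqrt hr hs hr1 hs1).trans <|
    mul_le_mul_of_nonneg_left
      (sum_sq_sqrt_sub_sqrt_le_sum_mul_log_sub_log hr hs (hs1.trans hr1.symm) hrs) (by norm_num)

end RelativeEntropy

/-! ### Laws, entropies and total correlation of discrete random variables -/

section Entropy

variable {Ω α β γ κ : Type*} [Fintype Ω]

open scoped Classical in
/-- The law of the random variable `X` on the finite space `Ω` with weights `p`. -/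
noncomputable def law (p : Ω → ℝ) (X : Ω → α) (a : α) : ℝ :=
  ∑ ω with X ω = a, p ω

/-- The conditional law `P(Y = b | X = a)`, which is `0` if `P(X = a) = 0`. -/
noncomputable def condLaw (p : Ω → ℝ) (X : Ω → α) (Y : Ω → β) (a : α) (b : β) : ℝ :=
  law p (fun ω => (X ω, Y ω)) (a, b) / law p X a

/-- The negative Shannon entropy `-H(X)`. -/
noncomputable def negEntropy (p : Ω → ℝ) (X : Ω → α) : ℝ :=
  ∑ ω, p ω * Real.log (law p X (X ω))

/-- The negative conditional Shannon entropy `-H(Y | X)`. -/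
noncomputable def negCondEntropy (p : Ω → ℝ) (X : Ω → α) (Y : Ω → β) : ℝ :=
  ∑ ω, p ω * Real.log (condLaw p X Y (X ω) (Y ω))

/-- The total correlation `∑ l, H(Y l | X) - H(Y | X)` of the random variables `Y l`, conditioned
on `X`: the mean relative entropy between their joint law and the product of their laws. -/
noncomputable def totalCorrelation [Fintype κ] (p : Ω → ℝ) (X : Ω → α) (Y : Ω → κ → β) : ℝ :=
  negCondEntropy p X Y - ∑ l, negCondEntropy p X fun ω => Y ω l

variable {p : Ω → ℝ}

section Law

variable (p) (X : Ω → α)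

theorem law_comp_of_injective {f : α → β} (hf : Function.Injective f) (a : α) :
    law p (f ∘ X) (f a) = law p X a := by
  classical
  exact sum_congr (by ext; simp only [mem_filter_univ, Function.comp_apply, hf.eq_iff])
    fun _ _ => rfl

theorem condLaw_comp_of_injective (Y : Ω → β) {f : β → γ} (hf : Function.Injective f) (a : α)
    (b : β) : condLaw p X (f ∘ Y) a (f b) = condLaw p X Y a b :=
  congrArg (· / _) (law_comp_of_injective p (fun ω => (X ω, Y ω))
    (Function.injective_id.prodMap hf) (a, b))

theorem sum_law_mul [Fintype α] (φ : α → ℝ) : ∑ a, law p X a * φ a = ∑ ω, p ω * φ (X ω) := by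
  classical
  simp only [law, sum_mul]
  rw [← sum_fiberwise univ X]
  exact sum_congr rfl fun a _ => sum_congr (by congr) fun ω hω => by rw [(mem_filter.1 hω).2]

theorem sum_law_prodMk [Fintype β] (Y : Ω → β) (a : α) :
    ∑ b, law p (fun ω => (X ω, Y ω)) (a, b) = law p X a := by
  classical
  simp only [law, Prod.mk.injEq, ← filter_filter]
  convert sum_fiberwise {ω | X ω = a} Y p

end Law

section Nonneg

variable (hp : ∀ ω, 0 ≤ p ω)
include hp

theorem law_nonneg (X : Ω → α) (a : α) : 0 ≤ law p X a :=
  sum_nonneg fun ω _ => hp ω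

theorem le_law_apply (X : Ω → α) (ω : Ω) : p ω ≤ law p X (X ω) := by
  classical
  exact single_le_sum (f := p) (fun ω _ => hp ω) (by simp)

theorem law_le_law_comp (X : Ω → α) (f : α → β) (a : α) : law p X a ≤ law p (f ∘ X) (f a) := by
  classical
  refine sum_le_sum_of_subset_of_nonneg (fun ω hω => ?_) fun ω _ _ => hp ω
  simp_all

theorem condLaw_nonneg (X : Ω → α) (Y : Ω → β) (a : α) (b : β) : 0 ≤ condLaw p X Y a b :=
  div_nonneg (law_nonneg hp _ _) (law_nonneg hp _ _)

theorem law_mul_condLaw (X : Ω → α) (Y : Ω → β) (a : α) (b : β) :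
    law p X a * condLaw p X Y a b = law p (fun ω => (X ω, Y ω)) (a, b) :=
  mul_div_cancel_of_imp' fun h =>
    le_antisymm ((law_le_law_comp hp _ Prod.fst (a, b)).trans_eq h) (law_nonneg hp _ _)

theorem condLaw_pos {ω : Ω} (hω : 0 < p ω) (X : Ω → α) (Y : Ω → β) :
    0 < condLaw p X Y (X ω) (Y ω) :=
  div_pos (hω.trans_le (le_law_apply hp (fun ω => (X ω, Y ω)) ω))
    (hω.trans_le (le_law_apply hp X ω))

theorem condLaw_le_condLaw_comp (X : Ω → α) (Y : Ω → β) (f : β → γ) (a : α) (b : β) :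
    condLaw p X Y a b ≤ condLaw p X (f ∘ Y) a (f b) :=
  div_le_div_of_nonneg_right (law_le_law_comp hp _ (Prod.map id f) (a, b)) (law_nonneg hp _ _)

theorem sum_law_mul_sum_condLaw_mul [Fintype α] [Fintype β] (X : Ω → α) (Y : Ω → β)
    (φ : α → β → ℝ) :
    ∑ a, law p X a * ∑ b, condLaw p X Y a b * φ a b = ∑ ω, p ω * φ (X ω) (Y ω) := by
  simp only [mul_sum, ← mul_assoc, law_mul_condLaw hp]
  rw [← sum_law_mul p (fun ω => (X ω, Y ω)) fun c => φ c.1 c.2, Fintype.sum_prod_type]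

theorem negEntropy_prodMk (X : Ω → α) (Y : Ω → β) :
    negEntropy p (fun ω => (X ω, Y ω)) = negEntropy p X + negCondEntropy p X Y := by
  rw [negEntropy, negEntropy, negCondEntropy, ← sum_add_distrib]
  refine sum_congr rfl fun ω _ => ?_
  rcases (hp ω).eq_or_lt with h | h
  · simp only [← h, zero_mul, add_zero]
  rw [← mul_add, ← law_mul_condLaw hp,
    Real.log_mul (h.trans_le (le_law_apply hp X ω)).ne' (condLaw_pos hp h X Y).ne']

end Nonneg

theorem negEntropy_comp_of_injective (p : Ω → ℝ) (X : Ω → α) {f : α → β}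
    (hf : Function.Injective f) : negEntropy p (f ∘ X) = negEntropy p X :=
  sum_congr rfl fun ω _ => by rw [Function.comp_apply, law_comp_of_injective p X hf]

theorem sum_condLaw [Fintype β] {X : Ω → α} {a : α} (ha : law p X a ≠ 0) (Y : Ω → β) :
    ∑ b, condLaw p X Y a b = 1 := by
  simp only [condLaw]
  rw [← sum_div, sum_law_prodMk, div_self ha]

theorem sum_prod_condLaw [Fintype β] [Fintype κ] [DecidableEq κ] {X : Ω → α} {a : α}
    (ha : law p X a ≠ 0) (Y : Ω → κ → β) :
    ∑ b : κ → β, ∏ l, condLaw p X (fun ω => Y ω l) a (b l) = 1 := by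
  rw [← Fintype.piFinset_univ,
    ← prod_univ_sum (fun _ => univ) fun l c => condLaw p X (fun ω => Y ω l) a c]
  exact prod_eq_one fun l _ => sum_condLaw ha _

section TotalCorrelation

variable (hp : ∀ ω, 0 ≤ p ω)
include hp

theorem condLaw_eq_zero_of_prod_eq_zero [Fintype κ] {X : Ω → α} {Y : Ω → κ → β} {a : α}
    {b : κ → β} (h : ∏ l, condLaw p X (fun ω => Y ω l) a (b l) = 0) : condLaw p X Y a b = 0 := by
  obtain ⟨l, -, hl⟩ := prod_eq_zero_iff.1 h
  exact le_antisymm ((condLaw_le_condLaw_comp hp X Y (fun y => y l) a b).trans_eq hl)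
    (condLaw_nonneg hp _ _ _ _)

theorem totalCorrelation_eq_sum_law_mul [Fintype α] [Fintype β] [Fintype κ] [DecidableEq κ]
    (X : Ω → α) (Y : Ω → κ → β) :
    totalCorrelation p X Y = ∑ a, law p X a * ∑ b, condLaw p X Y a b *
      (Real.log (condLaw p X Y a b)
        - Real.log (∏ l, condLaw p X (fun ω => Y ω l) a (b l))) := by
  rw [sum_law_mul_sum_condLaw_mul hp X Y fun a b => Real.log (condLaw p X Y a b)
      - Real.log (∏ l, condLaw p X (fun ω => Y ω l) a (b l)),
    totalCorrelation, negCondEntropy]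
  simp only [negCondEntropy]
  rw [sum_comm, ← sum_sub_distrib]
  refine sum_congr rfl fun ω _ => ?_
  rcases (hp ω).eq_or_lt with h | h
  · simp only [← h, zero_mul, sum_const_zero, sub_zero]
  rw [Real.log_prod fun l _ => (condLaw_pos hp h X fun ω => Y ω l).ne', mul_sub, mul_sum]

theorem sum_law_mul_sq_sum_abs_sub_le_totalCorrelation [Fintype α] [Fintype β] [Fintype κ]
    [DecidableEq κ] (X : Ω → α) (Y : Ω → κ → β) :
    ∑ a, law p X a * (∑ b, |condLaw p X Y a b - ∏ l, condLaw p X (fun ω => Y ω l) a (b l)|) ^ 2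
      ≤ 4 * totalCorrelation p X Y := by
  rw [totalCorrelation_eq_sum_law_mul hp, mul_sum]
  refine sum_le_sum fun a _ => ?_
  rw [mul_left_comm]
  rcases (law_nonneg hp X a).eq_or_lt with h | h
  · rw [← h, zero_mul, zero_mul]
  exact mul_le_mul_of_nonneg_left (sq_sum_abs_sub_le_four_mul_sum_mul_log_sub_log
    (fun b => condLaw_nonneg hp _ _ _ _) (fun b => prod_nonneg fun l _ => condLaw_nonneg hp _ _ _ _)
    (sum_condLaw h.ne' Y) (sum_prod_condLaw h.ne' Y)
    fun b => condLaw_eq_zero_of_prod_eq_zero hp) h.le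

end TotalCorrelation

section CrossEntropy

variable (hp : ∀ ω, 0 ≤ p ω) {q : β → ℝ} {D : ℝ} {X : Ω → α} {Y : Ω → β}
include hp

theorem sum_mul_log_le_negCondEntropy [Finite α] [Fintype β] (hq : ∀ b, 0 ≤ q b)
    (hq1 : ∑ b, q b ≤ 1) (hdom : ∀ a b, condLaw p X Y a b ≤ D * q b) :
    ∑ ω, p ω * Real.log (q (Y ω)) ≤ negCondEntropy p X Y := by
  cases nonempty_fintype α
  rw [negCondEntropy, ← sum_law_mul_sum_condLaw_mul hp X Y fun _ b => Real.log (q b),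
    ← sum_law_mul_sum_condLaw_mul hp X Y fun a b => Real.log (condLaw p X Y a b)]
  refine sum_le_sum fun a _ => ?_
  rcases (law_nonneg hp X a).eq_or_lt with h | h
  · rw [← h, zero_mul, zero_mul]
  refine mul_le_mul_of_nonneg_left (sum_mul_log_le_sum_mul_log
    (fun b => condLaw_nonneg hp _ _ _ _) hq (hq1.trans_eq (sum_condLaw h.ne' Y).symm)
    fun b hb => le_antisymm ?_ (condLaw_nonneg hp _ _ _ _)) h.le
  simpa only [hb, mul_zero] using hdom a b

theorem negCondEntropy_le_sum_mul_log_add_log (hp1 : ∑ ω, p ω = 1)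
    (hdom : ∀ a b, condLaw p X Y a b ≤ D * q b) :
    negCondEntropy p X Y ≤ ∑ ω, p ω * Real.log (q (Y ω)) + Real.log D := by
  rw [← mul_one (Real.log D), ← hp1, mul_sum, negCondEntropy, ← sum_add_distrib]
  refine sum_le_sum fun ω _ => ?_
  rcases (hp ω).eq_or_lt with h | h
  · simp only [← h, zero_mul, mul_zero, add_zero, le_refl]
  have hc := condLaw_pos hp h X Y
  have hDq : D * q (Y ω) ≠ 0 := (hc.trans_le (hdom _ _)).ne'
  rw [mul_comm (Real.log D), ← mul_add, add_comm,
    ← Real.log_mul (left_ne_zero_of_mul hDq) (right_ne_zero_of_mul hDq)]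
  exact mul_le_mul_of_nonneg_left (Real.log_le_log hc (hdom _ _)) h.le

end CrossEntropy

end Entropy

/-! ### Random embeddings -/

section RandomEmbedding

variable {κ κ' S : Type*} [Fintype S] [DecidableEq S]

theorem expect_perm_embedding_trans_eq (f : (κ ↪ S) → ℝ) (e e' : κ ↪ S) :
    𝔼 σ : Equiv.Perm S, f (e.trans σ.toEmbedding)
      = 𝔼 σ : Equiv.Perm S, f (e'.trans σ.toEmbedding) := by
  have := Finite.of_injective e e.injective
  obtain ⟨τ, hτ⟩ := Equiv.Perm.exists_extending_pair e e' e.injective e'.injective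
  refine (Fintype.expect_equiv (Equiv.mulRight τ) _ _ fun σ => congrArg f ?_).symm
  ext l
  simp [← hτ]

variable [Fintype κ] [Fintype κ']

theorem expect_embedding_eq_expect_perm (f : (κ ↪ S) → ℝ) (e : κ ↪ S) :
    𝔼 g, f g = 𝔼 σ : Equiv.Perm S, f (e.trans σ.toEmbedding) := by
  have : Nonempty (κ ↪ S) := ⟨e⟩
  calc 𝔼 g, f g = 𝔼 σ : Equiv.Perm S, 𝔼 g : κ ↪ S, f (g.trans σ.toEmbedding) := by
        rw [← Fintype.expect_const (ι := Equiv.Perm S) (𝔼 g, f g)]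
        exact expect_congr rfl fun σ _ => (Fintype.expect_equiv
          (Equiv.embeddingCongr (Equiv.refl κ) σ) _ _ fun g => rfl).symm
    _ = 𝔼 _g : κ ↪ S, 𝔼 σ : Equiv.Perm S, f (e.trans σ.toEmbedding) := by
        rw [expect_comm]
        exact expect_congr rfl fun g _ => expect_perm_embedding_trans_eq f g e
    _ = 𝔼 σ : Equiv.Perm S, f (e.trans σ.toEmbedding) := Fintype.expect_const _

omit [DecidableEq S] in
theorem expect_embedding_trans [Nonempty (κ' ↪ S)]
    (e : κ ↪ κ') (f : (κ ↪ S) → ℝ) :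
    𝔼 g : κ' ↪ S, f (e.trans g) = 𝔼 g, f g := by
  classical
  obtain ⟨g₀⟩ := ‹Nonempty (κ' ↪ S)›
  rw [expect_embedding_eq_expect_perm (fun g : κ' ↪ S => f (e.trans g)) g₀,
    expect_embedding_eq_expect_perm f (e.trans g₀)]
  rfl

theorem card_subtype_forall_ne (j : κ ↪ S) :
    Fintype.card {s // ∀ l, j l ≠ s} = Fintype.card S - Fintype.card κ := by
  rw [Fintype.card_subtype, show ({s | ∀ l, j l ≠ s} : Finset S) = (univ.map j)ᶜ by ext; simp,
    card_compl, card_map, card_univ]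

/-- The embeddings of `κ ⊕ κ'` as pairs of an embedding of `κ` and an embedding of `κ'` into the
complement of its range. -/
def sumEmbeddingEquivSigma :
    (κ ⊕ κ' ↪ S) ≃ Σ j : κ ↪ S, κ' ↪ {s // ∀ l, j l ≠ s} :=
  Equiv.sumEmbeddingEquivSigmaEmbeddingRestricted.trans
    (Equiv.sigmaCongrRight fun _ => Equiv.embeddingCongr (Equiv.refl _)
      (Equiv.subtypeEquivRight fun s => by simp))

theorem expect_embedding_expect_embedding_compl
    (f : (κ ⊕ κ' ↪ S) → ℝ) :
    𝔼 j : κ ↪ S, 𝔼 i : κ' ↪ {s // ∀ l, j l ≠ s}, f (sumEmbeddingEquivSigma.symm ⟨j, i⟩)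
      = 𝔼 g, f g := by
  have card_inner (j : κ ↪ S) : Fintype.card (κ' ↪ {s // ∀ l, j l ≠ s})
      = (Fintype.card S - Fintype.card κ).descFactorial (Fintype.card κ') := by
    rw [Fintype.card_embedding_eq, card_subtype_forall_ne]
  have card_sum : Fintype.card (κ ⊕ κ' ↪ S) = Fintype.card (κ ↪ S)
      * (Fintype.card S - Fintype.card κ).descFactorial (Fintype.card κ') := by
    rw [Fintype.card_congr sumEmbeddingEquivSigma, Fintype.card_sigma]
    simp only [card_inner, sum_const, card_univ, smul_eq_mul]
  simp only [Fintype.expect_eq_sum_div_card, card_inner, card_sum, Nat.cast_mul]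
  rw [← sum_div, div_div, mul_comm (Nat.cast (Nat.descFactorial _ _)),
    ← sumEmbeddingEquivSigma.symm.sum_comp, Fintype.sum_sigma]

end RandomEmbedding

/-! ### Entropies of random coordinates -/

section RandomCoordinates

variable {S B : Type*} [Fintype S] [DecidableEq S] [Fintype B] (p : (S → B) → ℝ)

/-- The mean of `-H(Z_{e_1}, …, Z_{e_r})` over distinct random coordinates `e_1, …, e_r` of a
random vector `Z` with law `p`. -/
noncomputable def meanNegEntropy (r : ℕ) : ℝ :=
  𝔼 e : Fin r ↪ S, negEntropy p fun z => z ∘ e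

theorem expect_negEntropy_embedding {κ : Type*} [Fintype κ] :
    𝔼 e : κ ↪ S, negEntropy p (fun z => z ∘ e) = meanNegEntropy p (Fintype.card κ) :=
  Fintype.expect_equiv (Equiv.embeddingCongr (Fintype.equivFin κ) (Equiv.refl S)) _ _ fun e =>
    (negEntropy_comp_of_injective p (fun z => z ∘ e)
      (Fintype.equivFin κ).symm.surjective.injective_comp_right).symm

theorem expect_negEntropy_embedding_comp {κ κ' : Type*} [Fintype κ] [Fintype κ']
    [Nonempty (κ' ↪ S)] {i : κ → κ'} (hi : Function.Injective i) :
    𝔼 e : κ' ↪ S, negEntropy p (fun z => z ∘ e ∘ i) = meanNegEntropy p (Fintype.card κ) :=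
  (expect_embedding_trans ⟨i, hi⟩ fun e => negEntropy p fun z => z ∘ e).trans
    (expect_negEntropy_embedding p)

variable {p} (hp : ∀ z, 0 ≤ p z)
include hp

theorem negCondEntropy_comp_inl_inr {κ κ' : Type*} (g : κ ⊕ κ' → S) :
    negCondEntropy p (fun z => z ∘ g ∘ Sum.inl) (fun z => z ∘ g ∘ Sum.inr)
      = negEntropy p (fun z => z ∘ g) - negEntropy p fun z => z ∘ g ∘ Sum.inl := by
  rw [eq_sub_iff_add_eq', ← negEntropy_prodMk hp]
  exact negEntropy_comp_of_injective p (fun z => z ∘ g)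
    (f := fun w : κ ⊕ κ' → B => (w ∘ Sum.inl, w ∘ Sum.inr))
    (Equiv.sumArrowEquivProdArrow κ κ' B).injective

theorem negCondEntropy_comp_inl_apply {κ κ' : Type*} (g : κ ⊕ κ' → S) (l : κ') :
    negCondEntropy p (fun z => z ∘ g ∘ Sum.inl) (fun z => z (g (Sum.inr l)))
      = negEntropy p (fun z => z ∘ g ∘ Sum.map id fun _ : Unit => l)
        - negEntropy p fun z => z ∘ g ∘ Sum.inl := by
  rw [eq_sub_iff_add_eq', ← negEntropy_prodMk hp]
  exact negEntropy_comp_of_injective p (fun z => z ∘ g ∘ Sum.map id fun _ : Unit => l)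
    (f := fun w : κ ⊕ Unit → B => (w ∘ Sum.inl, w (Sum.inr ())))
    (((Equiv.refl (κ → B)).prodCongr (Equiv.funUnique Unit B)).injective.comp
      (Equiv.sumArrowEquivProdArrow κ Unit B).injective)

theorem expect_negCondEntropy_apply {κ κ' : Type*} [Fintype κ] [Fintype κ']
    [Nonempty (κ ⊕ κ' ↪ S)] (l : κ') :
    𝔼 g : κ ⊕ κ' ↪ S, negCondEntropy p (fun z => z ∘ g ∘ Sum.inl) (fun z => z (g (Sum.inr l)))
      = meanNegEntropy p (Fintype.card κ + 1) - meanNegEntropy p (Fintype.card κ) := by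
  simp only [negCondEntropy_comp_inl_apply hp, expect_sub_distrib]
  rw [expect_negEntropy_embedding_comp p Sum.inl_injective, expect_negEntropy_embedding_comp p
      (Function.injective_id.sumMap (Function.injective_of_subsingleton fun _ : Unit => l)),
    Fintype.card_sum, Fintype.card_unit]

theorem expect_totalCorrelation {κ κ' : Type*} [Fintype κ] [Fintype κ']
    (hcard : Fintype.card κ + Fintype.card κ' ≤ Fintype.card S) :
    𝔼 j : κ ↪ S, 𝔼 i : κ' ↪ {s // ∀ l, j l ≠ s},
        totalCorrelation p (fun z => z ∘ j) (fun z l => z (i l))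
      = (meanNegEntropy p (Fintype.card κ + Fintype.card κ') - meanNegEntropy p (Fintype.card κ))
        - Fintype.card κ'
          * (meanNegEntropy p (Fintype.card κ + 1) - meanNegEntropy p (Fintype.card κ)) := by
  have : Nonempty (κ ⊕ κ' ↪ S) := Function.Embedding.nonempty_of_card_le (by simpa using hcard)
  calc _ = 𝔼 g : κ ⊕ κ' ↪ S,
        totalCorrelation p (fun z => z ∘ g ∘ Sum.inl) (fun z => z ∘ g ∘ Sum.inr) :=
        expect_embedding_expect_embedding_compl fun g =>
          totalCorrelation p (fun z => z ∘ g ∘ Sum.inl) (fun z => z ∘ g ∘ Sum.inr)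
    _ = _ := by
        simp only [totalCorrelation, expect_sub_distrib, expect_sum_comm,
          negCondEntropy_comp_inl_inr hp, Function.comp_apply, expect_negCondEntropy_apply hp,
          expect_negEntropy_embedding, sum_const, card_univ, nsmul_eq_mul, Fintype.card_sum]
        rw [expect_negEntropy_embedding_comp p Sum.inl_injective]

theorem exists_forall_meanNegEntropy_succ_sub_mem_Icc (hp1 : ∑ z, p z = 1) {q : B → ℝ} {D : ℝ}
    (hq : ∀ c, 0 ≤ q c) (hq1 : ∑ c, q c ≤ 1)
    (hdom : ∀ (r : ℕ) (g : Fin r ⊕ Unit ↪ S) x c,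
      condLaw p (fun z => z ∘ g ∘ Sum.inl) (fun z => z (g (Sum.inr ()))) x c ≤ D * q c) :
    ∃ G : ℝ, ∀ r < Fintype.card S,
      meanNegEntropy p (r + 1) - meanNegEntropy p r ∈ Set.Icc G (G + Real.log D) := by
  refine ⟨𝔼 g : Unit ↪ S, ∑ z, p z * Real.log (q (z (g ()))), fun r hr => ?_⟩
  have : Nonempty (Fin r ⊕ Unit ↪ S) := Function.Embedding.nonempty_of_card_le (by simpa using hr)
  have increment := expect_negCondEntropy_apply hp (κ := Fin r) ()
  rw [Fintype.card_fin] at increment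
  have cross := expect_embedding_trans (Function.Embedding.inr (α := Fin r))
    fun g : Unit ↪ S => ∑ z, p z * Real.log (q (z (g ())))
  rw [← increment, ← cross]
  refine ⟨expect_le_expect fun g _ => sum_mul_log_le_negCondEntropy hp hq hq1 (hdom r g), ?_⟩
  rw [← Fintype.expect_const (ι := Fin r ⊕ Unit ↪ S) (Real.log D), ← expect_add_distrib]
  exact expect_le_expect fun g _ => negCondEntropy_le_sum_mul_log_add_log hp hp1 (hdom r g)

end RandomCoordinates

/-! ### Second differences of sequences with nearly constant increments -/

theorem sum_range_add_sub_sum_range_le {a : ℕ → ℝ} {G L : ℝ} {T l n : ℕ} (hn : T + l ≤ n)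
    (ha : ∀ r < n, a r ∈ Set.Icc G (G + L)) :
    ∑ m ∈ range T, (a (m + l) - a m) ≤ l * L := by
  have telescope : ∑ m ∈ range T, (a (m + l) - a m) = ∑ i ∈ range l, (a (T + i) - a i) := by
    have h₁ := sum_range_add a T l
    rw [add_comm T l, sum_range_add a l T] at h₁
    simp only [sum_sub_distrib, add_comm _ l]
    linarith
  calc ∑ m ∈ range T, (a (m + l) - a m) = ∑ i ∈ range l, (a (T + i) - a i) := telescope
    _ ≤ ∑ _i ∈ range l, L := sum_le_sum fun i hi => by
        have hi := mem_range.1 hi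
        linarith [(ha (T + i) (by lia)).2, (ha i (by lia)).1]
    _ = l * L := by rw [sum_const, card_range, nsmul_eq_mul]

theorem exists_le_second_difference_le {A : ℕ → ℝ} {G L : ℝ} {t k n : ℕ} (htk : t + k ≤ n)
    (hL : 0 ≤ L) (hA : ∀ r < n, A (r + 1) - A r ∈ Set.Icc G (G + L)) :
    ∃ m ≤ t, (A (m + k) - A m) - k * (A (m + 1) - A m) ≤ k ^ 2 * L / (t + 1) := by
  have decompose (m : ℕ) : (A (m + k) - A m) - k * (A (m + 1) - A m)
      = ∑ l ∈ range k, ((A (m + l + 1) - A (m + l)) - (A (m + 1) - A m)) := by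
    rw [sum_sub_distrib, sum_const, card_range, nsmul_eq_mul]
    exact congrArg (· - _) (sum_range_sub (fun l => A (m + l)) k).symm
  have total : ∑ m ∈ range (t + 1), ((A (m + k) - A m) - k * (A (m + 1) - A m)) ≤ k ^ 2 * L := by
    simp only [decompose]
    rw [sum_comm]
    calc _ ≤ ∑ _l ∈ range k, k * L := sum_le_sum fun l hl => by
          have hl := mem_range.1 hl
          refine (sum_range_add_sub_sum_range_le (by lia) hA).trans ?_
          gcongr
      _ = k ^ 2 * L := by rw [sum_const, card_range, nsmul_eq_mul]; ring
  obtain ⟨m, hm, hle⟩ := exists_le_of_sum_le (s := range (t + 1)) ⟨0, by simp⟩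
    (g := fun _ => k ^ 2 * L / (t + 1)) (total.trans_eq (by
      rw [sum_const, card_range, nsmul_eq_mul]
      push_cast
      field_simp))
  exact ⟨m, Nat.lt_succ_iff.1 (mem_range.1 hm), hle⟩

/-! ### Product operators and partial traces -/

section TensorOp

variable {d : ℕ} {κ : Type} [Fintype κ]

theorem tensorOp_one : tensorOp (1 : κ → Matrix (Fin d) (Fin d) ℂ) = 1 := by
  ext a b
  simp [tensorOp, Matrix.one_apply, prod_ite_zero, funext_iff]

theorem tensorOp_conjTranspose (A : κ → Matrix (Fin d) (Fin d) ℂ) :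
    (tensorOp A)ᴴ = tensorOp fun l => (A l)ᴴ := by
  ext a b
  simp [tensorOp]

theorem tensorOp_update_apply [DecidableEq κ] (A : κ → Matrix (Fin d) (Fin d) ℂ) (s : κ)
    (X : Matrix (Fin d) (Fin d) ℂ) (a b : κ → Fin d) :
    tensorOp (Function.update A s X) a b
      = X (a s) (b s) * ∏ l ∈ univ.erase s, A l (a l) (b l) := by
  rw [tensorOp, Matrix.of_apply, ← mul_prod_erase _ _ (mem_univ s), Function.update_self]
  exact congrArg _ <| prod_congr rfl fun l hl => by
    rw [Function.update_of_ne (ne_of_mem_erase hl)]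

theorem tensorOp_update_smul_sub [DecidableEq κ] (A : κ → Matrix (Fin d) (Fin d) ℂ) (s : κ)
    (c : ℂ) (X Y : Matrix (Fin d) (Fin d) ℂ) :
    tensorOp (Function.update A s (c • X - Y))
      = c • tensorOp (Function.update A s X) - tensorOp (Function.update A s Y) := by
  ext a b
  simp only [tensorOp_update_apply, Matrix.sub_apply, Matrix.smul_apply, smul_eq_mul, sub_mul,
    mul_assoc]

variable [DecidableEq κ]

theorem tensorOp_mul (A B : κ → Matrix (Fin d) (Fin d) ℂ) :
    tensorOp A * tensorOp B = tensorOp fun l => A l * B l := by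
  ext a b
  simp only [tensorOp, Matrix.mul_apply, Matrix.of_apply, prod_univ_sum, Fintype.piFinset_univ,
    prod_mul_distrib]

theorem trace_tensorOp (A : κ → Matrix (Fin d) (Fin d) ℂ) :
    (tensorOp A).trace = ∏ l, (A l).trace := by
  simp only [Matrix.trace, tensorOp, Matrix.diag_apply, Matrix.of_apply, prod_univ_sum,
    Fintype.piFinset_univ]

theorem sum_piFinset_tensorOp {γ : Type*} (f : κ → γ → Matrix (Fin d) (Fin d) ℂ)
    (t : κ → Finset γ) :
    ∑ z ∈ Fintype.piFinset t, tensorOp (fun l => f l (z l))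
      = tensorOp fun l => ∑ c ∈ t l, f l c := by
  ext a b
  simp only [tensorOp, Matrix.sum_apply, Matrix.of_apply, prod_univ_sum]

theorem trace_tensorOp_mul (A : κ → Matrix (Fin d) (Fin d) ℂ) (ξ : QuditOp d κ) :
    (tensorOp A * ξ).trace = ∑ u, ∑ v, (∏ l, A l (v l) (u l)) * ξ u v := by
  rw [Matrix.trace, sum_comm]
  simp only [Matrix.diag_apply, Matrix.mul_apply, tensorOp, Matrix.of_apply]

end TensorOp

section PosSemidef

variable {β : Type*} [Fintype β]

open scoped MatrixOrder Matrix.Norms.L2Operator in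
theorem exists_eq_conjTranspose_mul_self {A : Matrix β β ℂ} (hA : A.PosSemidef) :
    ∃ B : Matrix β β ℂ, A = Bᴴ * B := by
  classical
  exact CStarAlgebra.nonneg_iff_eq_star_mul_self.1 (Matrix.nonneg_iff_posSemidef.2 hA)

theorem tensorOp_posSemidef {d : ℕ} {κ : Type} [Fintype κ] {A : κ → Matrix (Fin d) (Fin d) ℂ}
    (hA : ∀ l, (A l).PosSemidef) : (tensorOp A).PosSemidef := by
  classical
  choose B hB using fun l => exists_eq_conjTranspose_mul_self (hA l)
  rw [funext hB, ← tensorOp_mul, ← tensorOp_conjTranspose]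
  exact Matrix.posSemidef_conjTranspose_mul_self _

theorem trace_mul_nonneg {A ρ : Matrix β β ℂ} (hA : A.PosSemidef) (hρ : ρ.PosSemidef) :
    0 ≤ (A * ρ).trace := by
  obtain ⟨B, rfl⟩ := exists_eq_conjTranspose_mul_self hρ
  rw [← Matrix.mul_assoc, Matrix.trace_mul_comm, ← Matrix.mul_assoc]
  exact (hA.mul_mul_conjTranspose_same B).trace_nonneg

theorem trace_smul_one_sub_posSemidef [DecidableEq β] {A : Matrix β β ℂ} (hA : A.PosSemidef) :
    (A.trace • (1 : Matrix β β ℂ) - A).PosSemidef := by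
  set U : Matrix β β ℂ := hA.1.eigenvectorUnitary.1
  set D : Matrix β β ℂ := Matrix.diagonal fun i => (hA.1.eigenvalues i : ℂ)
  have unitary : U * Uᴴ = 1 := Unitary.coe_mul_star_self hA.1.eigenvectorUnitary
  have spectral : A = U * D * Uᴴ := by
    conv_lhs => rw [hA.1.spectral_theorem, Unitary.conjStarAlgAut_apply]
    rfl
  have diagonalized : A.trace • (1 : Matrix β β ℂ) - A
      = U * Matrix.diagonal (fun i => A.trace - (hA.1.eigenvalues i : ℂ)) * Uᴴ := by
    rw [← Matrix.diagonal_sub, ← Matrix.smul_one_eq_diagonal, Matrix.mul_sub, Matrix.sub_mul,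
      ← spectral, Matrix.mul_smul, Matrix.mul_one, Matrix.smul_mul, unitary]
  rw [diagonalized]
  refine (Matrix.PosSemidef.diagonal fun i => ?_).mul_mul_conjTranspose_same U
  rw [Pi.zero_apply, hA.1.trace_eq_sum_eigenvalues, sub_nonneg]
  exact (Complex.real_le_real.2 (single_le_sum (fun i _ => hA.eigenvalues_nonneg i)
    (mem_univ i))).trans_eq (Complex.ofReal_sum _ _)

end PosSemidef

section PartialTrace

variable {d : ℕ} {ι κ : Type} [Fintype ι] [DecidableEq ι] [Fintype κ]

theorem sum_mul_sum_ite_fiber {U A R : Type*} [Fintype U] [Fintype A] [DecidableEq A]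
    [NonUnitalNonAssocSemiring R] (f : U → A) (W : A → A → R) (σ : U → U → R) :
    ∑ a, ∑ b, W a b * ∑ u, ∑ v, (if f u = a ∧ f v = b then σ u v else 0)
      = ∑ u, ∑ v, W (f u) (f v) * σ u v := by
  simp only [← Fintype.sum_prod_type']
  simp only [mul_sum]
  rw [sum_comm]
  refine sum_congr rfl fun q _ => ?_
  rw [Fintype.sum_eq_single (f q.1, f q.2), if_pos ⟨rfl, rfl⟩]
  rintro ⟨a, b⟩ hab
  rw [if_neg fun h => hab (Prod.ext h.1.symm h.2.symm), mul_zero]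

theorem prod_extend_one_apply (A : κ → Matrix (Fin d) (Fin d) ℂ) (i : κ ↪ ι) (u v : ι → Fin d) :
    ∏ s, Function.extend i A 1 s (v s) (u s)
      = if ∀ s, (∀ l, i l ≠ s) → u s = v s then ∏ l, A l (v (i l)) (u (i l)) else 0 := by
  have off_range : ∏ s ∈ (univ.map i)ᶜ, Function.extend i A 1 s (v s) (u s)
      = if ∀ s, (∀ l, i l ≠ s) → u s = v s then 1 else 0 := by
    calc _ = ∏ s ∈ (univ.map i)ᶜ, if u s = v s then (1 : ℂ) else 0 :=
          prod_congr rfl fun s hs => by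
            rw [Function.extend_apply' A (1 : ι → Matrix _ _ ℂ) s (by simpa using hs),
              Pi.one_apply, Matrix.one_apply, if_congr eq_comm rfl rfl]
      _ = _ := by simp [prod_ite_zero]
  rw [← prod_mul_prod_compl (univ.map i), prod_map, off_range, mul_ite, mul_one, mul_zero]
  simp only [i.injective.extend_apply]

theorem marginal_smul (c : ℂ) (σ : QuditOp d ι) (i : κ ↪ ι) :
    marginal (c • σ) i = c • marginal σ i := by
  ext a b
  simp only [marginal, Matrix.of_apply, Matrix.smul_apply, smul_eq_mul, mul_sum, mul_ite,
    mul_zero]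

variable [DecidableEq κ]

theorem trace_tensorOp_mul_marginal (A : κ → Matrix (Fin d) (Fin d) ℂ) (σ : QuditOp d ι)
    (i : κ ↪ ι) :
    (tensorOp A * marginal σ i).trace = (tensorOp (Function.extend i A 1) * σ).trace := by
  have marginal_apply (a b : κ → Fin d) : marginal σ i a b = ∑ u, ∑ v,
      if u ∘ i = a ∧ v ∘ i = b then
        (if ∀ s, (∀ l, i l ≠ s) → u s = v s then σ u v else 0) else 0 := by
    simp only [marginal, Matrix.of_apply, funext_iff, Function.comp_apply, ← ite_and, and_assoc]
  simp only [trace_tensorOp_mul, marginal_apply]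
  rw [sum_mul_sum_ite_fiber (fun u => u ∘ i) fun a b => ∏ l, A l (b l) (a l)]
  simp only [prod_extend_one_apply, mul_ite, ite_mul, mul_zero, zero_mul, Function.comp_apply]

theorem trace_mul_siteMarginal (A : Matrix (Fin d) (Fin d) ℂ) (σ : QuditOp d ι) (s : ι) :
    (A * siteMarginal σ s).trace = (tensorOp (fun _ : Unit => A)
      * marginal σ ⟨fun _ => s, fun _ _ _ => rfl⟩).trace := by
  rw [Matrix.trace, Matrix.trace, ← (Equiv.funUnique Unit (Fin d)).symm.sum_comp]
  simp only [Matrix.diag_apply, Matrix.mul_apply,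
    ← (Equiv.funUnique Unit (Fin d)).symm.sum_comp, tensorOp, Matrix.of_apply, univ_unique,
    prod_singleton]
  rfl

theorem trace_tensorOp_mul_unnormalizedPost {N n m : ℕ} (M : Measurement d N)
    (ρ : QuditOp d (Fin n)) (j : Fin m ↪ Fin n) (x : Fin m → Fin N)
    {A : Fin n → Matrix (Fin d) (Fin d) ℂ} (hA : ∀ l, A (j l) = M.effect (x l)) :
    (tensorOp (fun s : Rest j => A s) * unnormalizedPost M ρ j x).trace
      = (tensorOp A * ρ).trace := by
  have split_prod (u v : Fin n → Fin d) : ∏ s, A s (v s) (u s)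
      = (∏ s : Rest j, A s (v s) (u s)) * ∏ l, M.effect (x l) (v (j l)) (u (j l)) := by
    have prod_compl (f : Fin n → ℂ) : ∏ s ∈ (univ.map j)ᶜ, f s = ∏ s : Rest j, f s :=
      prod_subtype _ (by simp) f
    rw [← prod_compl_mul_prod (univ.map j), prod_map, prod_compl]
    simp only [hA]
  have post_apply (a b : Rest j → Fin d) : unnormalizedPost M ρ j x a b = ∑ u, ∑ v,
      if (fun s : Rest j => u s) = a ∧ (fun s : Rest j => v s) = b then
        (∏ l, M.effect (x l) (v (j l)) (u (j l))) * ρ u v else 0 := by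
    simp only [unnormalizedPost, Matrix.of_apply, funext_iff]
  simp only [trace_tensorOp_mul, post_apply]
  rw [sum_mul_sum_ite_fiber (fun (u : Fin n → Fin d) (s : Rest j) => u s) fun a b =>
    ∏ s : Rest j, A s (b s) (a s)]
  simp only [split_prod, mul_assoc]

end PartialTrace

/-! ### Measurement outcomes -/

theorem extend_sumElim_const {α ι κ : Type*} [DecidableEq ι] (g : κ ⊕ Unit ↪ ι) (f : κ → α)
    (a : α) (h : ι → α) :
    Function.extend g (Sum.elim f fun _ => a) h
      = Function.update (Function.extend (g ∘ Sum.inl) f h) (g (Sum.inr ())) a := by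
  ext s
  rcases eq_or_ne s (g (Sum.inr ())) with rfl | hs
  · rw [g.injective.extend_apply, Function.update_self, Sum.elim_inr]
  rw [Function.update_of_ne hs]
  by_cases hl : ∃ l, g (Sum.inl l) = s
  · obtain ⟨l, rfl⟩ := hl
    rw [g.injective.extend_apply, Sum.elim_inl]
    exact ((g.injective.comp Sum.inl_injective).extend_apply f h l).symm
  · rw [Function.extend_apply' _ _ _ (by simpa [hs.symm] using hl),
      Function.extend_apply' (f := g ∘ Sum.inl) _ _ _ hl]

section OutcomeDist

variable {d N : ℕ} (M : Measurement d N) {ι κ : Type} [Fintype ι] [DecidableEq ι]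

theorem Measurement.apply_nonneg {ρ : QuditOp d ι} (hρ : ρ.PosSemidef) (z : ι → Fin N) :
    0 ≤ M.apply ρ z :=
  trace_mul_nonneg (tensorOp_posSemidef fun s => M.posSemidef (z s)) hρ

theorem Measurement.sum_apply (ξ : QuditOp d ι) : ∑ z, M.apply ξ z = ξ.trace := by
  have sum_tensorOp : ∑ z : ι → Fin N, tensorOp (fun s => M.effect (z s)) = 1 := by
    rw [← Fintype.piFinset_univ, sum_piFinset_tensorOp (fun _ => M.effect), ← tensorOp_one]
    exact congrArg tensorOp (funext fun _ => M.sum_eq_one)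
  simp only [Measurement.apply]
  rw [← Matrix.trace_sum, ← Matrix.sum_mul, sum_tensorOp, Matrix.one_mul]

/-- The law of the outcomes of measuring all sites of `ρ`. -/
noncomputable def outcomeDist (ρ : QuditOp d ι) (z : ι → Fin N) : ℝ :=
  (M.apply ρ z).re

variable {ρ : QuditOp d ι}

theorem ofReal_outcomeDist (hρ : ρ.PosSemidef) (z : ι → Fin N) :
    (outcomeDist M ρ z : ℂ) = M.apply ρ z :=
  (Complex.eq_re_of_ofReal_le (r := 0) (by exact_mod_cast M.apply_nonneg hρ z)).symm

theorem outcomeDist_nonneg (hρ : ρ.PosSemidef) (z : ι → Fin N) : 0 ≤ outcomeDist M ρ z :=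
  (Complex.nonneg_iff.1 (M.apply_nonneg hρ z)).1

theorem sum_outcomeDist (hρ : IsDensity ρ) : ∑ z, outcomeDist M ρ z = 1 := by
  simp only [outcomeDist]
  rw [← Complex.re_sum, M.sum_apply, hρ.2, Complex.one_re]

theorem sum_tensorOp_effect_of_comp_eq [Fintype κ] (g : κ ↪ ι) (x : κ → Fin N) :
    ∑ z : ι → Fin N with z ∘ g = x, tensorOp (fun s => M.effect (z s))
      = tensorOp (Function.extend g (fun l => M.effect (x l)) 1) := by
  have fiber_eq_pi : ({z | z ∘ g = x} : Finset (ι → Fin N))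
      = Fintype.piFinset fun s => {c | ∀ l, g l = s → c = x l} := by
    ext z
    simp only [mem_filter_univ, Fintype.mem_piFinset, funext_iff, Function.comp_apply]
    exact ⟨fun h s l hl => hl ▸ h l, fun h l => h _ l rfl⟩
  rw [fiber_eq_pi, sum_piFinset_tensorOp fun _ => M.effect]
  refine congrArg tensorOp (funext fun s => ?_)
  by_cases hs : ∃ l, g l = s
  · obtain ⟨l, rfl⟩ := hs
    simp [g.injective.extend_apply, g.injective.eq_iff, filter_eq']
  · rw [Function.extend_apply' _ _ _ hs, filter_true_of_mem fun c _ l hl => absurd ⟨l, hl⟩ hs]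
    exact M.sum_eq_one

theorem law_outcomeDist_comp (hρ : ρ.PosSemidef) (g : κ ↪ ι) (x : κ → Fin N) :
    (law (outcomeDist M ρ) (fun z => z ∘ g) x : ℂ)
      = (tensorOp (Function.extend g (fun l => M.effect (x l)) 1) * ρ).trace := by
  have := Fintype.ofInjective g g.injective
  rw [← sum_tensorOp_effect_of_comp_eq, Matrix.sum_mul, Matrix.trace_sum, law, Complex.ofReal_sum]
  exact sum_congr (by congr) fun z _ => ofReal_outcomeDist M hρ z

theorem law_outcomeDist_prodMk (hρ : ρ.PosSemidef) {κ' : Type}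
    (g : κ ⊕ κ' ↪ ι) (x : κ → Fin N) (y : κ' → Fin N) :
    (law (outcomeDist M ρ) (fun z => (z ∘ g ∘ Sum.inl, z ∘ g ∘ Sum.inr)) (x, y) : ℂ)
      = (tensorOp (Function.extend g (fun l => M.effect (Sum.elim x y l)) 1) * ρ).trace := by
  rw [← law_outcomeDist_comp M hρ]
  exact congrArg _ <| law_comp_of_injective (outcomeDist M ρ) (fun z => z ∘ g)
    (f := fun w : κ ⊕ κ' → Fin N => (w ∘ Sum.inl, w ∘ Sum.inr))
    (Equiv.sumArrowEquivProdArrow κ κ' (Fin N)).injective (Sum.elim x y)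

theorem law_outcomeDist_prodMk_le (hρ : ρ.PosSemidef) (g : κ ⊕ Unit ↪ ι) (x : κ → Fin N)
    (c : Fin N) :
    law (outcomeDist M ρ) (fun z => (z ∘ g ∘ Sum.inl, z ∘ g ∘ Sum.inr)) (x, fun _ => c)
      ≤ (M.effect c).trace.re * law (outcomeDist M ρ) (fun z => z ∘ g ∘ Sum.inl) x := by
  classical
  set s := g (Sum.inr ()) with hs
  set A := Function.extend (g ∘ Sum.inl) (fun l => M.effect (x l)) 1 with hA
  have effect_posSemidef (s : ι) : (A s).PosSemidef := by
    rw [hA, Function.extend_def]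
    split_ifs
    exacts [M.posSemidef _, Matrix.PosSemidef.one]
  have joint : (law (outcomeDist M ρ) (fun z => (z ∘ g ∘ Sum.inl, z ∘ g ∘ Sum.inr))
      (x, fun _ => c) : ℂ) = (tensorOp (Function.update A s (M.effect c)) * ρ).trace := by
    rw [law_outcomeDist_prodMk M hρ, hA, hs, ← extend_sumElim_const]
    congr! 4
    ext1 (l | l) <;> rfl
  have outcomes : (law (outcomeDist M ρ) (fun z => z ∘ g ∘ Sum.inl) x : ℂ)
      = (tensorOp (Function.update A s 1) * ρ).trace := by
    have hAs : A s = 1 := Function.extend_apply' (f := g ∘ Sum.inl) _ _ _ (by simp [hs])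
    rw [← hAs, Function.update_eq_self]
    exact law_outcomeDist_comp M hρ ⟨g ∘ Sum.inl, g.injective.comp Sum.inl_injective⟩ x
  have nonneg : 0 ≤ (tensorOp (Function.update A s
      ((M.effect c).trace • 1 - M.effect c)) * ρ).trace :=
    trace_mul_nonneg (tensorOp_posSemidef fun l => Function.update_apply A s _ l ▸ by
      split_ifs
      exacts [trace_smul_one_sub_posSemidef (M.posSemidef c), effect_posSemidef l]) hρ
  rw [tensorOp_update_smul_sub, Matrix.sub_mul, Matrix.smul_mul, Matrix.trace_sub,
    Matrix.trace_smul, ← joint, ← outcomes, smul_eq_mul, mul_comm] at nonneg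
  have := (Complex.nonneg_iff.1 nonneg).1
  rw [Complex.sub_re, Complex.re_ofReal_mul, Complex.ofReal_re] at this
  linarith

theorem condLaw_outcomeDist_le (hρ : ρ.PosSemidef) (g : κ ⊕ Unit ↪ ι) (x : κ → Fin N)
    (c : Fin N) :
    condLaw (outcomeDist M ρ) (fun z => z ∘ g ∘ Sum.inl) (fun z => z (g (Sum.inr ()))) x c
      ≤ (M.effect c).trace.re := by
  rw [← condLaw_comp_of_injective (outcomeDist M ρ) _ _
    (Function.const_injective (α := Unit) (β := Fin N))]
  exact div_le_of_le_mul₀ (law_nonneg (outcomeDist_nonneg M hρ) _ _)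
    (Complex.nonneg_iff.1 (M.posSemidef c).trace_nonneg).1 (law_outcomeDist_prodMk_le M hρ g x c)

end OutcomeDist

/-! ### Post-measurement states -/

section PostState

variable {d N n m : ℕ} (M : Measurement d N) {ρ : QuditOp d (Fin n)} (hρ : ρ.PosSemidef)
  (j : Fin m ↪ Fin n) (x : Fin m → Fin N)
include hρ

theorem outcomeProb_eq_law :
    outcomeProb M ρ j x = law (outcomeDist M ρ) (fun z => z ∘ j) x := by
  have trace_post := trace_tensorOp_mul_unnormalizedPost M ρ j x
    (A := Function.extend j (fun l => M.effect (x l)) 1) fun l => j.injective.extend_apply _ _ l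
  have extend_rest (s : Rest j) : Function.extend j (fun l => M.effect (x l)) 1 (s : Fin n) = 1 :=
    Function.extend_apply' _ _ _ fun ⟨l, hl⟩ => s.2 l hl
  simp only [extend_rest] at trace_post
  rw [← Pi.one_def, tensorOp_one, Matrix.one_mul, ← law_outcomeDist_comp M hρ] at trace_post
  rw [outcomeProb, trace_post, Complex.ofReal_re]

variable {κ : Type} [Fintype κ] [DecidableEq κ] (i : κ ↪ Rest j) (y : κ → Fin N)

theorem apply_marginal_unnormalizedPost :
    M.apply (marginal (unnormalizedPost M ρ j x) i) y
      = law (outcomeDist M ρ) (fun z => (z ∘ j, fun l => z (i l))) (x, y) := by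
  set g : Fin m ⊕ κ ↪ Fin n := sumEmbeddingEquivSigma.symm ⟨j, i⟩
  set A := Function.extend g (fun l => M.effect (Sum.elim x y l)) 1
  have extend_rest : Function.extend i (fun l => M.effect (y l)) 1 = fun s : Rest j => A s := by
    ext1 s
    by_cases hs : ∃ l, i l = s
    · obtain ⟨l, rfl⟩ := hs
      rw [i.injective.extend_apply]
      exact (g.injective.extend_apply (fun l => M.effect (Sum.elim x y l)) 1 (Sum.inr l)).symm
    · rw [Function.extend_apply' _ _ _ hs]
      refine (Function.extend_apply' _ (1 : Fin n → Matrix _ _ ℂ) s ?_).symm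
      rintro ⟨l | l, hl⟩
      exacts [s.2 l hl, hs ⟨l, Subtype.ext hl⟩]
  rw [Measurement.apply, trace_tensorOp_mul_marginal, extend_rest,
    trace_tensorOp_mul_unnormalizedPost M ρ j x fun l => g.injective.extend_apply _ _ (Sum.inl l),
    ← law_outcomeDist_prodMk M hρ]
  rfl

theorem apply_marginal_postState :
    M.apply (marginal (postState M ρ j x) i) y
      = condLaw (outcomeDist M ρ) (fun z => z ∘ j) (fun z l => z (i l)) x y := by
  rw [postState, marginal_smul, Measurement.apply, Matrix.mul_smul, Matrix.trace_smul, condLaw,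
    ← Measurement.apply, apply_marginal_unnormalizedPost M hρ, outcomeProb_eq_law M hρ,
    Complex.ofReal_div, smul_eq_mul, div_eq_inv_mul]

theorem apply_tensorOp_siteMarginal_postState :
    M.apply (tensorOp fun l => siteMarginal (postState M ρ j x) (i l)) y
      = ∏ l, condLaw (outcomeDist M ρ) (fun z => z ∘ j) (fun z => z (i l)) x (y l) := by
  rw [Measurement.apply, tensorOp_mul, trace_tensorOp, Complex.ofReal_prod]
  refine prod_congr rfl fun l _ => ?_
  rw [trace_mul_siteMarginal, ← condLaw_comp_of_injective (outcomeDist M ρ) _ _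
    (Function.const_injective (α := Unit) (β := Fin N))]
  exact apply_marginal_postState M hρ j x ⟨fun _ : Unit => i l, fun _ _ _ => rfl⟩ fun _ => y l

end PostState

section MeanSqDist

variable {d N n : ℕ} {M : Measurement d N} {ρ : QuditOp d (Fin n)} {k m : ℕ} {K : ℝ}

theorem sum_outcomeProb_mul_traceNorm_sq_le (hK : 0 ≤ K)
    (hM : ∀ ξ : QuditOp d (Fin k), ξ.trace = 0 → traceNorm ξ ^ 2 ≤ K * (∑ y, ‖M.apply ξ y‖) ^ 2)
    (hρ : ρ.PosSemidef) (j : Fin m ↪ Fin n) (i : Fin k ↪ Rest j) :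
    ∑ x, outcomeProb M ρ j x * traceNorm (marginal (postState M ρ j x) i
        - tensorOp (fun l => siteMarginal (postState M ρ j x) (i l))) ^ 2
      ≤ K * (4 * totalCorrelation (outcomeDist M ρ) (fun z => z ∘ j) fun z l => z (i l)) := by
  set p := outcomeDist M ρ
  have hp : ∀ z, 0 ≤ p z := outcomeDist_nonneg M hρ
  refine le_trans ?_ (mul_le_mul_of_nonneg_left
    (sum_law_mul_sq_sum_abs_sub_le_totalCorrelation hp (fun z => z ∘ j) fun z l => z (i l)) hK)
  rw [mul_sum]
  refine sum_le_sum fun x _ => ?_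
  rw [outcomeProb_eq_law M hρ, mul_left_comm]
  rcases (law_nonneg hp (fun z => z ∘ j) x).eq_or_lt with hx | hx
  · rw [← hx, zero_mul, zero_mul]
  refine mul_le_mul_of_nonneg_left ?_ hx.le
  set ξ := marginal (postState M ρ j x) i
    - tensorOp (fun l => siteMarginal (postState M ρ j x) (i l))
  have apply_ξ (y : Fin k → Fin N) : M.apply ξ y
      = ((condLaw p (fun z => z ∘ j) (fun z l => z (i l)) x y
          - ∏ l, condLaw p (fun z => z ∘ j) (fun z => z (i l)) x (y l) : ℝ) : ℂ) := by
    rw [Complex.ofReal_sub, ← apply_marginal_postState M hρ,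
      ← apply_tensorOp_siteMarginal_postState M hρ, Measurement.apply, Matrix.mul_sub,
      Matrix.trace_sub]
    rfl
  have trace_ξ : ξ.trace = 0 := by
    rw [← M.sum_apply, sum_congr rfl fun y _ => apply_ξ y, ← Complex.ofReal_sum,
      sum_sub_distrib, sum_condLaw hx.ne', sum_prod_condLaw hx.ne', sub_self, Complex.ofReal_zero]
  refine (hM ξ trace_ξ).trans_eq ?_
  simp only [apply_ξ, Complex.norm_real, Real.norm_eq_abs]

theorem meanSqDistToProduct_le (hK : 0 ≤ K)
    (hM : ∀ ξ : QuditOp d (Fin k), ξ.trace = 0 → traceNorm ξ ^ 2 ≤ K * (∑ y, ‖M.apply ξ y‖) ^ 2)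
    (hρ : ρ.PosSemidef) (m : ℕ) :
    meanSqDistToProduct M ρ k m ≤ K * (4 * 𝔼 j : Fin m ↪ Fin n, 𝔼 i : Fin k ↪ Rest j,
      totalCorrelation (outcomeDist M ρ) (fun z => z ∘ j) fun z l => z (i l)) := by
  simp only [meanSqDistToProduct, mul_expect]
  refine expect_le_expect fun j _ => ?_
  rw [← expect_sum_comm]
  exact expect_le_expect fun i _ => sum_outcomeProb_mul_traceNorm_sq_le hK hM hρ j i

end MeanSqDist

section OutcomeEntropy

variable {d N n : ℕ} {M : Measurement d N} {ρ : QuditOp d (Fin n)}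

theorem exists_forall_meanNegEntropy_outcomeDist_succ_sub_mem_Icc (hd : 0 < d) (hρ : IsDensity ρ) :
    ∃ G : ℝ, ∀ r < n, meanNegEntropy (outcomeDist M ρ) (r + 1) - meanNegEntropy (outcomeDist M ρ) r
      ∈ Set.Icc G (G + Real.log d) := by
  have hd' : (d : ℝ) ≠ 0 := by positivity
  set q : Fin N → ℝ := fun c => (M.effect c).trace.re / d
  have hq (c : Fin N) : 0 ≤ q c :=
    div_nonneg (Complex.nonneg_iff.1 (M.posSemidef c).trace_nonneg).1 d.cast_nonneg
  have sum_q : ∑ c, q c = 1 := by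
    rw [← sum_div, ← Complex.re_sum, ← Matrix.trace_sum, M.sum_eq_one, Matrix.trace_one,
      Fintype.card_fin, Complex.natCast_re, div_self hd']
  have condLaw_le (r : ℕ) (g : Fin r ⊕ Unit ↪ Fin n) (x : Fin r → Fin N) (c : Fin N) :
      condLaw (outcomeDist M ρ) (fun z => z ∘ g ∘ Sum.inl) (fun z => z (g (Sum.inr ()))) x c
        ≤ d * q c := by
    rw [mul_div_cancel₀ _ hd']
    exact condLaw_outcomeDist_le M hρ.1 g x c
  simpa only [Fintype.card_fin] using exists_forall_meanNegEntropy_succ_sub_mem_Icc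
    (outcomeDist_nonneg M hρ.1) (sum_outcomeDist M hρ) hq sum_q.le condLaw_le

theorem meanSqDistToProduct_le_meanNegEntropy {k m : ℕ} {K : ℝ} (hK : 0 ≤ K)
    (hM : ∀ ξ : QuditOp d (Fin k), ξ.trace = 0 → traceNorm ξ ^ 2 ≤ K * (∑ y, ‖M.apply ξ y‖) ^ 2)
    (hρ : ρ.PosSemidef) (hmk : m + k ≤ n) :
    meanSqDistToProduct M ρ k m ≤ K * (4 *
      ((meanNegEntropy (outcomeDist M ρ) (m + k) - meanNegEntropy (outcomeDist M ρ) m)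
        - k * (meanNegEntropy (outcomeDist M ρ) (m + 1)
          - meanNegEntropy (outcomeDist M ρ) m))) := by
  refine (meanSqDistToProduct_le hK hM hρ m).trans_eq ?_
  have := expect_totalCorrelation (outcomeDist_nonneg M hρ) (κ := Fin m) (κ' := Fin k)
    (by simpa only [Fintype.card_fin] using hmk)
  simp only [Fintype.card_fin] at this
  rw [← this]
  congr!

end OutcomeEntropy

end DeFinetti

theorem mainTheorem6_general {d N n k t : ℕ} (hd : 0 < d) {M : DeFinetti.Measurement d N} {K : ℝ}
    (hK : 0 ≤ K)
    (hM : ∀ ξ : DeFinetti.QuditOp d (Fin k), ξ.trace = 0 →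
      DeFinetti.traceNorm ξ ^ 2 ≤ K * (∑ y, ‖M.apply ξ y‖) ^ 2)
    {ρ : DeFinetti.QuditOp d (Fin n)} (hρ : DeFinetti.IsDensity ρ) (htk : t + k ≤ n) :
    ∃ m ≤ t, DeFinetti.meanSqDistToProduct M ρ k m
      ≤ 4 * Real.log d * K * (k : ℝ) ^ 2 / (t + 1) := by
  obtain ⟨G, increment_mem⟩ :=
    DeFinetti.exists_forall_meanNegEntropy_outcomeDist_succ_sub_mem_Icc (M := M) hd hρ
  obtain ⟨m, hmt, hm⟩ :=
    DeFinetti.exists_le_second_difference_le htk (Real.log_natCast_nonneg d) increment_mem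
  refine ⟨m, hmt, ?_⟩
  calc _ ≤ K * (4 * (k ^ 2 * Real.log d / (t + 1))) :=
        (DeFinetti.meanSqDistToProduct_le_meanNegEntropy hK hM hρ.1 (by lia)).trans (by gcongr)
    _ = _ := by ring

theorem mainTheorem6 (d : ℕ) (hd : 0 < d) :
    (∃ (N : ℕ) (M : DeFinetti.Measurement d N), M.IsTomographic) ∧
    ∀ (N : ℕ) (M : DeFinetti.Measurement d N), M.IsTomographic →
      ∀ (n k : ℕ) (ρ : DeFinetti.QuditOp d (Fin n)), DeFinetti.IsDensity ρ →
        ∀ t : ℕ, 1 ≤ t → t + k ≤ n →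
          ∃ m : ℕ, m ≤ t ∧
            DeFinetti.meanSqDistToProduct M ρ k m ≤
              4 * Real.log d * (18 * (d : ℝ)) ^ k * (k : ℝ) ^ 2 / (t : ℝ) := by
  refine ⟨DeFinetti.exists_isTomographic hd, fun N M hM n k ρ hρ t ht htk => ?_⟩
  have traceNorm_sq_le (ξ : DeFinetti.QuditOp d (Fin k)) (hξ : ξ.trace = 0) :
      DeFinetti.traceNorm ξ ^ 2 ≤ (18 * (d : ℝ)) ^ k * (∑ y, ‖M.apply ξ y‖) ^ 2 := by
    rcases k.eq_zero_or_pos with rfl | hk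
    · rw [DeFinetti.traceNorm_eq_zero_of_trace_eq_zero hξ, zero_pow two_ne_zero]
      positivity
    · exact ((DeFinetti.Measurement.isTomographic_iff hd).1 hM).2 k hk ξ hξ
  obtain ⟨m, hmt, hm⟩ := mainTheorem6_general hd (by positivity) traceNorm_sq_le hρ htk
  refine ⟨m, hmt, hm.trans ?_⟩
  have := Real.log_natCast_nonneg d
  gcongr
  linarith
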